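/- A finite poset is $(\mathbf{2+2})$-free if it has no induced subposet isomorphic to the disjoint union of two $2$-element chains. For $n\ge 0$ let $p_n$ be the number of isomorphism classes of $(\mathbf{2+2})$-free posets on $n$ elements. Then, as an identity of formal power series in $\mathbb{Z}[[t]]$ (the sum on the right converging coefficientwise), $$P(t)=\sum_{n\ge 0}p_n\,t^n=\sum_{n\ge 0}\ \prod_{i=1}^n\bigl(1-(1-t)^i\bigr).$$ Moreover, for every $n\ge 0$, $p_n$ is also equal to each of the following numbers: (a) the number of ascent sequences of length $n$, that is, of sequences $(x_1,\dots,x_n)$ of nonnegative integers with $x_1=0$ (if $n\ge1$) and $0\le x_i\le 1+|\{1\le j<i-1 : x_j<x_{j+1}\}|$ for $2\le i\le n$; (b) the number of permutations in $\mathcal{R}_n$, that is, of permutations $\pi_1\cdots\pi_n$ of $\{1,\dots,n\}$ for which there are no indices $i<j<k$ with $\pi_k<\pi_i<\pi_j$, $j=i+1$ and $\pi_i=\pi_k+1$; (c) the number of Stoimenow's regular linearized chord diagrams on $2n$ points, that is, of fixed point free involutions $\pi$ of $\{1,\dots,2n\}$ such that $\pi_i>\pi_{i+1}$ implies $\pi_i>i\ge\pi_{i+1}$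 (this is Zagier's enumeration). -/

import Mathlib

open scoped PowerSeries.WithPiTopology

namespace Fishburn

/-! ### Unlabeled (2+2)-free posets -/

/-- A poset is (2+2)-free if it has no induced subposet isomorphic to the disjoint union of two
2-element chains (Mathlib's order on `α ⊕ β` is the disjoint union: elements of different summands
are incomparable). -/
def TwoPlusTwoFree (α : Type*) [PartialOrder α] : Prop :=
  IsEmpty ((Fin 2 ⊕ Fin 2) ↪o α)

/-- The (2+2)-free partial orders on the labeled set `Fin n`. -/
def LabeledPoset (n : ℕ) : Type :=
  {P : PartialOrder (Fin n) // @TwoPlusTwoFree (Fin n) P}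

/-- Isomorphism of posets. -/
def posetSetoid (n : ℕ) : Setoid (LabeledPoset n) where
  r P Q := Nonempty (P.1.le ≃r Q.1.le)
  iseqv :=
    { refl := fun P => ⟨RelIso.refl P.1.le⟩
      symm := fun ⟨e⟩ => ⟨e.symm⟩
      trans := fun ⟨e⟩ ⟨f⟩ => ⟨e.trans f⟩ }

/-- Unlabeled (2+2)-free posets on `n` elements: isomorphism classes. -/
def UnlabeledPoset (n : ℕ) : Type :=
  Quotient (posetSetoid n)

/-! ### Ascent sequences -/

/-- The number of ascents of a sequence. -/
noncomputable def asc {k : ℕ} (x : Fin k → ℕ) : ℕ :=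
  Nat.card {j : Fin k // ∃ h : (j : ℕ) + 1 < k, x j < x ⟨(j : ℕ) + 1, h⟩}

/-- `x` is an ascent sequence: the first entry is `0`, and every later entry is at most one more
than the number of ascents of the sequence of entries before it. -/
def IsAscentSequence {n : ℕ} (x : Fin n → ℕ) : Prop :=
  ∀ i : Fin n,
    ((i : ℕ) = 0 → x i = 0) ∧
    (0 < (i : ℕ) → x i ≤ 1 + asc (fun j : Fin (i : ℕ) => x (Fin.castLE i.isLt.le j)))

/-! ### Pattern-avoiding permutations -/

/-- `π i π j π k` (with `i < j < k`) being order-isomorphic to `231` forces `j ≠ i + 1` or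
`π i ≠ π k + 1`. -/
def IsR {n : ℕ} (π : Equiv.Perm (Fin n)) : Prop :=
  ∀ i j k : Fin n, i < j → j < k → π k < π i → π i < π j →
    (j : ℕ) ≠ (i : ℕ) + 1 ∨ (π i : ℕ) ≠ (π k : ℕ) + 1

/-! ### Regular linearized chord diagrams -/

/-- A fixed point free involution in which every descent crosses the main diagonal:
if `π i > π (i + 1)` then `π i > i ≥ π (i + 1)`. -/
def IsRegularChordDiagram {m : ℕ} (π : Equiv.Perm (Fin m)) : Prop :=
  (∀ i, π (π i) = i) ∧ (∀ i, π i ≠ i) ∧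
    ∀ i j : Fin m, (j : ℕ) = (i : ℕ) + 1 → π j < π i → i < π i ∧ π j ≤ i

/-! ### Generating functions -/

/-- The generating function of unlabeled (2+2)-free posets by number of elements. -/
noncomputable def posetSeries : PowerSeries ℤ :=
  PowerSeries.mk fun n => (Nat.card (UnlabeledPoset n) : ℤ)

/-- The generating function of ascent sequences by length. -/
noncomputable def ascentSeries : PowerSeries ℤ :=
  PowerSeries.mk fun n => (Nat.card {x : Fin n → ℕ // IsAscentSequence x} : ℤ)

/-- The generating function of the permutations in `R_n` by length. -/
noncomputable def permSeries : PowerSeries ℤ :=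
  PowerSeries.mk fun n => (Nat.card {π : Equiv.Perm (Fin n) // IsR π} : ℤ)

/-- The generating function of regular linearized chord diagrams on `2n` points by the number `n`
of chords. -/
noncomputable def chordSeries : PowerSeries ℤ :=
  PowerSeries.mk fun n =>
    (Nat.card {π : Equiv.Perm (Fin (2 * n)) // IsRegularChordDiagram π} : ℤ)

end Fishburn

/-!
Ascent sequences grow by their last entry, permutations in `R_n` by their largest entry, and both
follow the same generating tree, so both have the generating function `1 + t * F(0, 0)`, where
`F(a, l)` counts the nodes below a node with label `(a, l)` by depth. On the other hand, a
(2+2)-free poset has a canonical representation by intervals, and the chords of a regular diagram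
span intervals of runs; both are thereby encoded by multisets of intervals whose sets of left and of
right endpoints are both `{0, …, m - 1}`, and inclusion–exclusion counts these. Put `q = 1 - t` and
`(q; q)_k = (1 - q) ⋯ (1 - q ^ k)`. Modulo `t ^ N`, the functional `x ^ k ↦ (q; q)_k * q ^ -k` on
polynomials of degree below `N` maps the truncation of `(1 - x) ^ -(a + 1 - l) * (1 - q * x) ^ -l`
to `q * F(a, l)`, and both generating functions reduce to the partial sum `∑_{k < N} (q; q)_k`.
-/

namespace Fishburn

open PowerSeries Finset

/-! ### q-Pochhammer symbols -/

section QSeries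

variable {R : Type*} [CommRing R]

/-- The `q`-Pochhammer symbol `(q; q)_n`. -/
def qPoch (q : R) (n : ℕ) : R := ∏ i ∈ Icc 1 n, (1 - q ^ i)

@[simp]
theorem qPoch_zero (q : R) : qPoch q 0 = 1 := by simp [qPoch]

theorem qPoch_succ (q : R) (n : ℕ) : qPoch q (n + 1) = qPoch q n * (1 - q ^ (n + 1)) := by
  simp [qPoch, prod_Icc_succ_top]

theorem one_sub_pow_dvd_qPoch (q : R) (n : ℕ) : (1 - q) ^ n ∣ qPoch q n := by
  simpa [qPoch] using prod_dvd_prod_of_dvd (fun _ => 1 - q) (fun i => 1 - q ^ i)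
    (s := Icc 1 n) fun i _ => one_sub_dvd_one_sub_pow q i

/-- The geometric series `1 / (1 - x)`. -/
def geomSeries (R : Type*) [CommRing R] : R⟦X⟧ := PowerSeries.mk 1

theorem geomSeries_mul : geomSeries R * (1 - X) = 1 :=
  PowerSeries.mk_one_mul_one_sub_eq_one R

theorem rescale_geomSeries_mul (q : R) : rescale q (geomSeries R) * (1 - C q * X) = 1 := by
  simpa [rescale_X] using congrArg (rescale q) (geomSeries_mul (R := R))

/-- The series `(1 - x) ^ -(a + 1 - l) * (1 - q * x) ^ -l`, which `pochFunctional` maps to `q` times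
the generating function of the subtree at a node with label `(a, l)`; only `l ≤ a + 1` matters. -/
noncomputable def treeKernel (q : R) (a l : ℕ) : R⟦X⟧ :=
  geomSeries R ^ (a + 1 - l) * rescale q (geomSeries R) ^ l

theorem X_mul_sum_treeKernel (q : R) (a : ℕ) :
    X * ((1 - C q) * ∑ l ∈ range (a + 2), treeKernel q a l) =
      (1 - C q * X) * geomSeries R ^ (a + 1) - (1 - X) * rescale q (geomSeries R) ^ (a + 1) := by
  have hu := geomSeries_mul (R := R)
  have hw := rescale_geomSeries_mul q
  have hsum := (Commute.all (rescale q (geomSeries R)) (geomSeries R)).geom_sum₂_mul (a + 2)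
  simp only [mul_comm (rescale q (geomSeries R) ^ _)] at hsum
  simp only [treeKernel]
  set u := geomSeries R
  set w := rescale q u
  set S := ∑ l ∈ range (a + 2), u ^ (a + 1 - l) * w ^ l
  calc
    _ = (u * (1 - X)) * S * (1 - C q * X) - (w * (1 - C q * X)) * S * (1 - X) := by
      rw [hu, hw]; ring
    _ = -((1 - X) * (1 - C q * X) * (S * (w - u))) := by ring
    _ = -((1 - X) * (1 - C q * X) * (w ^ (a + 2) - u ^ (a + 2))) := congrArg (- (_ * ·)) hsum
    _ = (u * (1 - X)) * (1 - C q * X) * u ^ (a + 1) -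
        (w * (1 - C q * X)) * (1 - X) * w ^ (a + 1) := by ring
    _ = _ := by rw [hu, hw]; ring

theorem treeKernel_step (q : R) {a l : ℕ} (hl : l ≤ a) :
    (1 - C q) * treeKernel q (a + 1) (l + 1) =
      treeKernel q a l - treeKernel q a (l + 1) + (1 - C q) * treeKernel q a (l + 1) := by
  obtain ⟨b, rfl⟩ := Nat.exists_eq_add_of_le hl
  have hu := geomSeries_mul (R := R)
  have hw := rescale_geomSeries_mul q
  simp only [treeKernel, show l + b + 1 + 1 - (l + 1) = b + 1 by lia,
    show l + b + 1 - l = b + 1 by lia, show l + b + 1 - (l + 1) = b by lia, pow_succ]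
  set u := geomSeries R
  set w := rescale q u
  linear_combination (-C q * u ^ b * w ^ l * w) * hu + u ^ b * w ^ l * u * hw

theorem one_sub_mul_sum_treeKernel (q : R) {a l : ℕ} (hl : l ≤ a + 1) :
    (1 - C q) * ∑ l' ∈ range (a + 2), treeKernel q (if l' ≤ l then a else a + 1) l' =
      treeKernel q a l - rescale q (geomSeries R) ^ (a + 1) +
        (1 - C q) * ∑ l' ∈ range (a + 2), treeKernel q a l' := by
  have hsplit (f : ℕ → R⟦X⟧) : ∑ l' ∈ range (a + 2), f l' =
      ∑ l' ∈ range (l + 1), f l' + ∑ i ∈ Ico l (a + 1), f (i + 1) := by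
    rw [sum_Ico_add' f, sum_range_add_sum_Ico f (by lia)]
  have hlow : ∑ l' ∈ range (l + 1), treeKernel q (if l' ≤ l then a else a + 1) l' =
      ∑ l' ∈ range (l + 1), treeKernel q a l' :=
    sum_congr rfl fun l' h => by rw [if_pos (by grind)]
  have hhigh : (1 - C q) *
      ∑ i ∈ Ico l (a + 1), treeKernel q (if i + 1 ≤ l then a else a + 1) (i + 1) =
      treeKernel q a l - treeKernel q a (a + 1) +
        (1 - C q) * ∑ i ∈ Ico l (a + 1), treeKernel q a (i + 1) := by
    rw [← neg_sub (treeKernel q a (a + 1)), ← sum_Ico_sub (treeKernel q a) hl, ← sum_neg_distrib,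
      mul_sum, mul_sum, ← sum_add_distrib]
    refine sum_congr rfl fun i hi => ?_
    rw [if_neg (by grind), treeKernel_step q (by grind), neg_sub]
  rw [hsplit, hsplit, hlow, mul_add, hhigh, mul_add]
  simp only [treeKernel, tsub_self, pow_zero, one_mul, Nat.reduceSubDiff]
  ring

/-- The truncation to degrees below `N` of the linear functional `x ^ k ↦ (q; q)_k q⁻ᵏ`. -/
noncomputable def pochFunctional (q : Rˣ) (N : ℕ) : R⟦X⟧ →ₗ[R] R :=
  ∑ k ∈ range N, (qPoch (q : R) k * ↑q⁻¹ ^ k) • coeff k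

theorem pochFunctional_apply (q : Rˣ) (N : ℕ) (f : R⟦X⟧) :
    pochFunctional q N f = ∑ k ∈ range N, qPoch (q : R) k * ↑q⁻¹ ^ k * coeff k f := by
  simp [pochFunctional]

theorem pochFunctional_of_X_mul_eq (q : Rˣ) (N : ℕ) {f h : R⟦X⟧}
    (hf : X * f = rescale (q : R) h - (1 - C (q : R) * X) * h) :
    pochFunctional q N f =
      q * coeff 0 h - q * (qPoch (q : R) N * ↑q⁻¹ ^ N * coeff N h) := by
  have hcoeff (k : ℕ) : coeff k f = q * coeff k h - (1 - q ^ (k + 1)) * coeff (k + 1) h := by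
    rw [← coeff_succ_X_mul, hf, sub_mul, mul_assoc]
    simp only [map_sub, one_mul, coeff_rescale, coeff_C_mul, coeff_succ_X_mul]
    ring
  have hstep (k : ℕ) : qPoch (q : R) k * ↑q⁻¹ ^ k * coeff k f =
      q * (qPoch (q : R) k * ↑q⁻¹ ^ k * coeff k h) -
        q * (qPoch (q : R) (k + 1) * ↑q⁻¹ ^ (k + 1) * coeff (k + 1) h) := by
    rw [hcoeff, qPoch_succ, pow_succ (↑q⁻¹ : R)]
    linear_combination
      (qPoch (q : R) k * (1 - q ^ (k + 1)) * ↑q⁻¹ ^ k * coeff (k + 1) h) * q.mul_inv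
  simp only [pochFunctional_apply, hstep, sum_range_sub', qPoch_zero, pow_zero, one_mul]

theorem pochFunctional_treeKernel (q : Rˣ) (N : ℕ) {a l : ℕ} (hl : l ≤ a + 1) :
    pochFunctional q N (treeKernel q a l) =
      q - q * (qPoch (q : R) N * ↑q⁻¹ ^ N * coeff N (geomSeries R ^ (a + 1))) +
        (1 - q) * ∑ l' ∈ range (a + 2),
          pochFunctional q N (treeKernel q (if l' ≤ l then a else a + 1) l') := by
  have hrec := one_sub_mul_sum_treeKernel (q : R) hl
  have hX := X_mul_sum_treeKernel (q : R) a
  set boundary := rescale (q : R) (geomSeries R) ^ (a + 1) -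
    (1 - C (q : R)) * ∑ l' ∈ range (a + 2), treeKernel (q : R) a l'
  have hboundary := pochFunctional_of_X_mul_eq q N (f := boundary) (h := geomSeries R ^ (a + 1))
    (by rw [map_pow, mul_sub, hX]; ring)
  have hK : treeKernel (q : R) a l = boundary + (1 - (q : R)) •
      ∑ l' ∈ range (a + 2), treeKernel (q : R) (if l' ≤ l then a else a + 1) l' := by
    rw [smul_eq_C_mul, map_sub, map_one, hrec]
    ring
  rw [hK, map_add, map_smul, map_sum, hboundary, smul_eq_mul]
  simp [geomSeries]

theorem one_sub_pow_dvd_pochFunctional_sub (q : Rˣ) {F : ℕ → ℕ → R}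
    (hF : ∀ a l, F a l = 1 + (1 - q) * ∑ l' ∈ range (a + 2), F (if l' ≤ l then a else a + 1) l')
    {n N : ℕ} (hn : n ≤ N) {a l : ℕ} (hl : l ≤ a + 1) :
    (1 - q : R) ^ n ∣ pochFunctional q N (treeKernel q a l) - q * F a l := by
  induction n generalizing a l with
  | zero => simp
  | succ n ih =>
    have hdiff : pochFunctional q N (treeKernel q a l) - q * F a l =
        (1 - q) * ∑ l' ∈ range (a + 2),
          (pochFunctional q N (treeKernel q (if l' ≤ l then a else a + 1) l') -
            q * F (if l' ≤ l then a else a + 1) l') -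
        qPoch (q : R) N * (q * ↑q⁻¹ ^ N * coeff N (geomSeries R ^ (a + 1))) := by
      rw [pochFunctional_treeKernel q N hl, hF a l, sum_sub_distrib, ← mul_sum]
      ring
    rw [hdiff, pow_succ']
    refine dvd_sub (mul_dvd_mul_left _ (dvd_sum fun l' hl' => ih (by lia) (by grind))) ?_
    rw [← pow_succ']
    exact ((pow_dvd_pow _ hn).trans (one_sub_pow_dvd_qPoch _ N)).mul_right _

theorem one_sub_mul_sum_qPoch (q : Rˣ) (N : ℕ) :
    (1 - q) * ∑ k ∈ range N, qPoch (q : R) k * ↑q⁻¹ ^ k =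
      q * (∑ k ∈ range N, qPoch (q : R) k - 1 + qPoch (q : R) N * ↑q⁻¹ ^ N) := by
  induction N with
  | zero => simp
  | succ N ih =>
    have hpow : (↑q⁻¹ : R) ^ N * q ^ N = 1 := by rw [← mul_pow, q.inv_mul, one_pow]
    rw [sum_range_succ, sum_range_succ, mul_add, ih, qPoch_succ]
    linear_combination
      (-qPoch (q : R) N * ↑q⁻¹ ^ N * (1 - q ^ (N + 1))) * q.mul_inv + q * qPoch (q : R) N * hpow

theorem one_sub_pow_dvd_tree_sub_sum_qPoch (q : Rˣ) {F : ℕ → ℕ → R}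
    (hF : ∀ a l, F a l = 1 + (1 - q) * ∑ l' ∈ range (a + 2), F (if l' ≤ l then a else a + 1) l')
    (N : ℕ) : (1 - q : R) ^ N ∣ 1 + (1 - q) * F 0 0 - ∑ k ∈ range N, qPoch (q : R) k := by
  have hroot := one_sub_pow_dvd_pochFunctional_sub q hF le_rfl (N := N) (Nat.zero_le (0 + 1))
  have hsum : pochFunctional q N (treeKernel q 0 0) =
      ∑ k ∈ range N, qPoch (q : R) k * ↑q⁻¹ ^ k := by
    simp [pochFunctional_apply, treeKernel, geomSeries]
  have hdiff : 1 + (1 - q) * F 0 0 - ∑ k ∈ range N, qPoch (q : R) k =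
      qPoch (q : R) N * ↑q⁻¹ ^ N - (pochFunctional q N (treeKernel q 0 0) - q * F 0 0) *
        (↑q⁻¹ * (1 - q)) := by
    rw [hsum]
    linear_combination (↑q⁻¹ : R) * one_sub_mul_sum_qPoch q N + (∑ k ∈ range N, qPoch (q : R) k - 1
      + qPoch (q : R) N * ↑q⁻¹ ^ N - (1 - q) * F 0 0) * q.inv_mul
  rw [hdiff]
  exact dvd_sub ((one_sub_pow_dvd_qPoch _ N).mul_right _) (hroot.mul_right _)

/-- The signed sum over all `b : {1, …, m} → {0, 1}` of `∏ j, (Q ^ (d + b 1 + ⋯ + b j) - 1)`, with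
sign `(-1) ^ #{i | b i = 0}`, by recursion on `b 1`. For `d = 0` and `Q = 1 / (1 - t)` it is the
generating function of upper triangular `m × m` matrices of natural numbers without zero rows or
columns: `b` sieves out the zero rows and the factors are the columns. -/
def sieveSum (Q : R) : ℕ → ℕ → R
  | 0, _ => 1
  | m + 1, d => (Q ^ (d + 1) - 1) * sieveSum Q m (d + 1) - (Q ^ d - 1) * sieveSum Q m d

theorem one_sub_pow_dvd_sieveSum (q : Rˣ) (m d : ℕ) :
    (1 - q : R) ^ m ∣ sieveSum (↑q⁻¹ : R) m d := by
  induction m generalizing d with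
  | zero => simp
  | succ m ih =>
    have hfactor (k : ℕ) : (1 - q : R) ∣ ↑q⁻¹ ^ k - 1 := by
      have hpow : (↑q⁻¹ : R) ^ k * q ^ k = 1 := by rw [← mul_pow, q.inv_mul, one_pow]
      rw [show (↑q⁻¹ : R) ^ k - 1 = (1 - q ^ k) * ↑q⁻¹ ^ k by linear_combination hpow]
      exact (one_sub_dvd_one_sub_pow _ k).mul_right _
    rw [pow_succ', sieveSum]
    exact dvd_sub (mul_dvd_mul (hfactor _) (ih _)) (mul_dvd_mul (hfactor _) (ih _))

theorem inv_pow_mul_sum_sieveSum (q : Rˣ) (N d : ℕ) :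
    ↑q⁻¹ ^ d * ∑ m ∈ range N, sieveSum (↑q⁻¹ : R) m d =
      1 + (1 - q ^ (d + 1)) *
        (↑q⁻¹ ^ (d + 1) * ∑ m ∈ range N, sieveSum (↑q⁻¹ : R) m (d + 1)) -
        sieveSum (↑q⁻¹ : R) N d := by
  have hpow : (↑q⁻¹ : R) ^ (d + 1) * q ^ (d + 1) = 1 := by rw [← mul_pow, q.inv_mul, one_pow]
  have hsum := sum_range_succ (fun m => sieveSum (↑q⁻¹ : R) m d) N
  rw [sum_range_succ'] at hsum
  simp only [sieveSum, sum_sub_distrib, ← mul_sum] at hsum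
  linear_combination -hsum + (∑ m ∈ range N, sieveSum (↑q⁻¹ : R) m (d + 1)) * hpow

theorem one_sub_pow_dvd_sum_sieveSum_sub_sum_qPoch (q : Rˣ) (N : ℕ) :
    (1 - q : R) ^ N ∣
      ∑ m ∈ range N, sieveSum (↑q⁻¹ : R) m 0 - ∑ k ∈ range N, qPoch (q : R) k := by
  have hunfold (r : ℕ) : ∑ m ∈ range N, sieveSum (↑q⁻¹ : R) m 0 = ∑ k ∈ range r, qPoch (q : R) k +
      qPoch (q : R) r * (↑q⁻¹ ^ r * ∑ m ∈ range N, sieveSum (↑q⁻¹ : R) m r) -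
      ∑ k ∈ range r, qPoch (q : R) k * sieveSum (↑q⁻¹ : R) N k := by
    induction r with
    | zero => simp
    | succ r ih =>
      rw [ih, inv_pow_mul_sum_sieveSum, sum_range_succ, sum_range_succ, qPoch_succ]
      ring
  rw [hunfold N, add_sub_assoc, add_sub_cancel_left]
  exact dvd_sub ((one_sub_pow_dvd_qPoch _ N).mul_right _)
    (dvd_sum fun k _ => (one_sub_pow_dvd_sieveSum q N k).mul_left _)

theorem sieveSum_eq_sum_powerset (Q : R) {a m : ℕ} (ham : a ≤ m) (d : ℕ) :
    sieveSum Q (m - a) d = ∑ S ∈ (Ico a m).powerset,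
      (-1) ^ #S * ∏ j ∈ Ico a m, (Q ^ (d + #(Icc a j \ S)) - 1) := by
  induction ham using Nat.decreasingInduction generalizing d with
  | self => simp [sieveSum]
  | of_succ a ha ih =>
    rw [show m - a = (m - (a + 1)) + 1 by lia, sieveSum, ih, ih,
      ← insert_Ico_add_one_left_eq_Ico ha, sum_powerset_insert (by simp), sub_eq_add_neg, mul_sum,
      mul_sum, ← sum_neg_distrib]
    congr 1 <;> refine sum_congr rfl fun S hS => ?_
    all_goals
      have haS : a ∉ S := by grind
      have hIcc {j : ℕ} (hj : a ≤ j) : Icc a j = insert a (Icc (a + 1) j) :=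
        (insert_Icc_add_one_left_eq_Icc hj).symm
      rw [prod_insert (by simp)]
    · have hcard {j : ℕ} (hj : a ≤ j) : #(Icc a j \ S) = #(Icc (a + 1) j \ S) + 1 := by
        rw [hIcc hj, insert_sdiff_of_notMem _ haS, card_insert_of_notMem (by simp)]
      have hprod : ∏ j ∈ Ico (a + 1) m, (Q ^ (d + #(Icc a j \ S)) - 1) =
          ∏ j ∈ Ico (a + 1) m, (Q ^ (d + 1 + #(Icc (a + 1) j \ S)) - 1) :=
        prod_congr rfl fun j hj => by rw [hcard (by grind), add_assoc d 1, add_comm 1]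
      rw [hcard le_rfl, hprod]
      simp only [Icc_eq_empty_of_lt a.lt_succ_self, empty_sdiff, card_empty, zero_add]
      ring
    · have hcard {j : ℕ} (hj : a ≤ j) : #(Icc a j \ insert a S) = #(Icc (a + 1) j \ S) := by
        rw [hIcc hj, insert_sdiff_insert, sdiff_insert_of_notMem (by simp)]
      have hprod : ∏ j ∈ Ico (a + 1) m, (Q ^ (d + #(Icc a j \ insert a S)) - 1) =
          ∏ j ∈ Ico (a + 1) m, (Q ^ (d + #(Icc (a + 1) j \ S)) - 1) :=
        prod_congr rfl fun j hj => by rw [hcard (by grind)]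
      rw [hcard le_rfl, hprod, card_insert_of_notMem haS]
      simp only [Icc_eq_empty_of_lt a.lt_succ_self, empty_sdiff, card_empty, add_zero]
      ring

end QSeries

/-! ### Ascent trees -/

/-- The number of nodes at depth `k` below a node with label `(a, l)` in the generating tree in
which a node `(a, l)` has children with second label `l' = 0, …, a + 1`, the first label growing by
one exactly when `l < l'`. -/
def treeCount : ℕ → ℕ → ℕ → ℕ
  | 0, _, _ => 1
  | k + 1, a, l => ∑ l' ∈ range (a + 2), treeCount k (if l' ≤ l then a else a + 1) l'

/-- The generating function of the nodes below `(a, l)` by depth. -/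
def treeSeries (a l : ℕ) : ℤ⟦X⟧ :=
  PowerSeries.mk fun k => (treeCount k a l : ℤ)

theorem treeSeries_eq (a l : ℕ) :
    treeSeries a l =
      1 + X * ∑ l' ∈ range (a + 2), treeSeries (if l' ≤ l then a else a + 1) l' := by
  ext n
  cases n with
  | zero => simp [treeSeries, treeCount]
  | succ n => simp [treeSeries, treeCount, coeff_succ_X_mul, coeff_one]

/-- A way of growing the objects of size `n + 1` from those of size `n` along the generating tree of
`treeCount`: `asc` and `last` are the two labels of a node, and the sizes are shifted by one, so
that `Y n` consists of the objects of size `n + 1`. -/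
structure AscentTree (Y : ℕ → Type*) where
  asc {n : ℕ} : Y n → ℕ
  last {n : ℕ} : Y n → ℕ
  root : Unique (Y 0)
  asc_root : asc root.default = 0
  last_root : last root.default = 0
  child (n : ℕ) : (Σ y : Y n, Fin (asc y + 2)) ≃ Y (n + 1)
  last_child {n : ℕ} (y : Y n) (j : Fin (asc y + 2)) : last (child n ⟨y, j⟩) = j
  asc_child {n : ℕ} (y : Y n) (j : Fin (asc y + 2)) :
    asc (child n ⟨y, j⟩) = if (j : ℕ) ≤ last y then asc y else asc y + 1

namespace AscentTree

variable {Y : ℕ → Type*} (T : AscentTree Y)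

include T in
theorem finite (n : ℕ) : Finite (Y n) := by
  induction n with
  | zero =>
    have := T.root
    infer_instance
  | succ n ih => exact .of_equiv _ (T.child n)

theorem sum_treeCount_succ [∀ n, Fintype (Y n)] (n k : ℕ) :
    ∑ y : Y (n + 1), treeCount k (T.asc y) (T.last y) =
      ∑ y : Y n, treeCount (k + 1) (T.asc y) (T.last y) := by
  rw [← (T.child n).sum_comp, Fintype.sum_sigma]
  refine sum_congr rfl fun y _ => ?_
  simp only [T.last_child, T.asc_child, treeCount]
  exact Fin.sum_univ_eq_sum_range
    (fun l' => treeCount k (if l' ≤ T.last y then T.asc y else T.asc y + 1) l') _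

include T in
theorem card_eq_treeCount (n : ℕ) : Nat.card (Y n) = treeCount n 0 0 := by
  have := fun n => @Fintype.ofFinite (Y n) (T.finite n)
  have hdescend (k : ℕ) {n : ℕ} :
      ∑ y : Y (n + k), treeCount 0 (T.asc y) (T.last y) =
        ∑ y : Y n, treeCount k (T.asc y) (T.last y) := by
    induction k generalizing n with
    | zero => rfl
    | succ k ih => rw [← T.sum_treeCount_succ, ← ih, Nat.add_right_comm, Nat.add_assoc]
  let _ := T.root
  simpa [treeCount, T.asc_root, T.last_root] using hdescend n (n := 0)

theorem mk_card_eq {Y : ℕ → Type*} [Unique (Y 0)] (T : AscentTree fun n => Y (n + 1)) :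
    PowerSeries.mk (fun n => (Nat.card (Y n) : ℤ)) = 1 + X * treeSeries 0 0 := by
  ext n
  cases n with
  | zero => simp
  | succ n => simp [treeSeries, coeff_succ_X_mul, coeff_one, T.card_eq_treeCount]

end AscentTree

/-! ### Ascent sequences -/

theorem asc_eq_sum {n : ℕ} (x : Fin (n + 1) → ℕ) :
    asc x = ∑ j : Fin n, if x j.castSucc < x j.succ then 1 else 0 := by
  let e : {j : Fin (n + 1) // ∃ h : (j : ℕ) + 1 < n + 1, x j < x ⟨(j : ℕ) + 1, h⟩} ≃
      {j : Fin n // x j.castSucc < x j.succ} :=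
    { toFun := fun j => ⟨⟨j.1, Nat.lt_of_succ_lt_succ j.2.1⟩, j.2.2⟩
      invFun := fun j => ⟨j.1.castSucc, j.1.succ.isLt, j.2⟩ }
  rw [asc, Nat.card_congr e, Nat.card_eq_fintype_card, Fintype.card_subtype, card_filter]

theorem asc_succ {n : ℕ} (x : Fin (n + 2) → ℕ) :
    asc x = asc (Fin.init x) +
      if x (Fin.last n).castSucc < x (Fin.last (n + 1)) then 1 else 0 := by
  rw [asc_eq_sum, asc_eq_sum, Fin.sum_univ_castSucc]
  rfl

theorem isAscentSequence_succ_iff {n : ℕ} (x : Fin (n + 2) → ℕ) :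
    IsAscentSequence x ↔ IsAscentSequence (Fin.init x) ∧
      x (Fin.last (n + 1)) ≤ 1 + asc (Fin.init x) := by
  rw [IsAscentSequence, Fin.forall_fin_succ']
  exact and_congr .rfl
    ⟨fun h => h.2 n.succ_pos, fun h => ⟨fun h0 => absurd h0 n.succ_ne_zero, fun _ => h⟩⟩

theorem isAscentSequence_one_iff (x : Fin 1 → ℕ) : IsAscentSequence x ↔ x = 0 := by
  simp [IsAscentSequence, funext_iff]

/-- Ascent sequences grow by appending an admissible entry. -/
noncomputable def ascentSequenceTree :
    AscentTree fun n => {x : Fin (n + 1) → ℕ // IsAscentSequence x} where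
  asc x := asc x.1
  last x := x.1 (Fin.last _)
  root :=
    { default := ⟨0, (isAscentSequence_one_iff _).2 rfl⟩
      uniq := fun x => Subtype.ext ((isAscentSequence_one_iff _).1 x.2) }
  asc_root := by simp [asc_eq_sum]
  last_root := rfl
  child n :=
    { toFun := fun y => ⟨Fin.snoc (α := fun _ => ℕ) y.1.1 y.2,
        (isAscentSequence_succ_iff _).2 ⟨by simpa using y.1.2, by simpa using by lia⟩⟩
      invFun := fun x => ⟨⟨Fin.init x.1, ((isAscentSequence_succ_iff _).1 x.2).1⟩,
        ⟨x.1 (Fin.last _), by have := ((isAscentSequence_succ_iff _).1 x.2).2; grind⟩⟩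
      left_inv := fun ⟨⟨x, hx⟩, j⟩ => by
        have hinit : Fin.init (Fin.snoc (α := fun _ => ℕ) x j) = x := Fin.init_snoc ..
        refine Sigma.ext (Subtype.ext hinit) ?_
        simp [Fin.heq_ext_iff, hinit]
      right_inv := fun x => by simp }
  last_child x j := by simp
  asc_child x j := by
    rw [Equiv.coe_fn_mk, asc_succ]
    simp only [Fin.init_snoc, Fin.snoc_castSucc, Fin.snoc_last]
    grind

theorem ascentSeries_eq : ascentSeries = 1 + X * treeSeries 0 0 := by
  have : Unique {x : Fin 0 → ℕ // IsAscentSequence x} :=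
    { default := ⟨Fin.elim0, fun i => i.elim0⟩
      uniq := fun x => Subtype.ext (Subsingleton.elim _ _) }
  exact ascentSequenceTree.mk_card_eq (Y := fun n => {x : Fin n → ℕ // IsAscentSequence x})

/-! ### Counting below a bound -/

theorem exists_count_eq_of_lt {P : ℕ → Prop} [DecidablePred P] {k N : ℕ} (hk : k < Nat.count P N) :
    ∃ x < N, P x ∧ Nat.count P x = k :=
  ⟨Nat.nth P k, Nat.nth_lt_of_lt_count hk,
    Nat.nth_mem k fun hP => hk.trans_le (Nat.count_le_card hP N),
    Nat.count_nth fun hP => hk.trans_le (Nat.count_le_card hP N)⟩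

theorem count_congr {P Q : ℕ → Prop} [DecidablePred P] [DecidablePred Q] {N : ℕ}
    (h : ∀ k < N, P k ↔ Q k) : Nat.count P N = Nat.count Q N := by
  simp only [Nat.count_eq_card_filter_range]
  exact congrArg _ (filter_congr fun k hk => h k (mem_range.1 hk))

/-- The numbers below `N` satisfying `P`, numbered in increasing order. -/
noncomputable def countEquiv (P : ℕ → Prop) [DecidablePred P] (N : ℕ) :
    {p : Fin N // P p} ≃ Fin (Nat.count P N) :=
  Equiv.ofBijective (fun p => ⟨Nat.count P p, Nat.count_strict_mono p.2 p.1.isLt⟩)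
    ⟨fun p p' h => Subtype.ext <| Fin.ext <| Nat.count_injective p.2 p'.2 (Fin.ext_iff.1 h),
      fun k => by
        obtain ⟨x, hxN, hx, hk⟩ := exists_count_eq_of_lt k.isLt
        exact ⟨⟨⟨x, hxN⟩, hx⟩, Fin.ext hk⟩⟩

/-! ### Pattern-avoiding permutations -/

/-- The condition `IsR` on the inverse permutation `ρ`, whose value `ρ v` is the position of the
entry `v`. -/
def IsRInv {n : ℕ} (ρ : Equiv.Perm (Fin n)) : Prop :=
  ∀ u v c : Fin n, (v : ℕ) = u + 1 → ρ v < ρ u → (ρ c : ℕ) = ρ v + 1 → c < v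

theorem val_apply_ne {n : ℕ} (ρ : Equiv.Perm (Fin n)) {u v : Fin n} (h : u ≠ v) :
    (ρ u : ℕ) ≠ ρ v :=
  Fin.val_ne_iff.2 (ρ.injective.ne h)

theorem isR_iff_isRInv_symm {n : ℕ} (π : Equiv.Perm (Fin n)) : IsR π ↔ IsRInv π.symm := by
  constructor
  · intro h u v c hvu hlt hc
    by_contra! hvc
    have hne : v ≠ c := by grind
    have hne' := val_apply_ne π.symm (u := c) (v := u) (by grind)
    have := h (π.symm v) (π.symm c) (π.symm u) (by grind) (by grind) (by grind) (by grind)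
    grind
  · intro h i j k hij hjk _ hij'
    by_contra! hcon
    have := h (π k) (π i) (π j) hcon.2 (by simpa using hij.trans hjk) (by simpa using hcon.1)
    exact absurd this hij'.not_gt

/-- Insertion of a new largest entry at position `p`, as an operation on inverse permutations. -/
def insertMax {n : ℕ} (p : Fin (n + 1)) (ρ : Equiv.Perm (Fin n)) : Equiv.Perm (Fin (n + 1)) :=
  ((finSuccEquiv' (Fin.last n)).trans ρ.optionCongr).trans (finSuccEquiv' p).symm

@[simp] theorem insertMax_last {n : ℕ} (p : Fin (n + 1)) (ρ : Equiv.Perm (Fin n)) :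
    insertMax p ρ (Fin.last n) = p := by
  simp [insertMax]

@[simp] theorem insertMax_castSucc {n : ℕ} (p : Fin (n + 1)) (ρ : Equiv.Perm (Fin n))
    (v : Fin n) : insertMax p ρ v.castSucc = p.succAbove (ρ v) := by
  rw [← Fin.succAbove_last_apply]
  simp only [insertMax, Equiv.trans_apply, finSuccEquiv'_succAbove]
  simp

theorem insertMax_bijective (n : ℕ) :
    Function.Bijective fun x : Equiv.Perm (Fin n) × Fin (n + 1) => insertMax x.2 x.1 := by
  rw [Fintype.bijective_iff_injective_and_card]
  refine ⟨?_, by simp [Fintype.card_perm, Nat.factorial_succ, mul_comm]⟩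
  rintro ⟨ρ, p⟩ ⟨ρ', p'⟩ h
  obtain rfl : p = p' := by simpa using Equiv.congr_fun h (Fin.last n)
  obtain rfl : ρ = ρ' := Equiv.ext fun v => by simpa using Equiv.congr_fun h v.castSucc
  rfl

/-- A new largest entry may be inserted at position `p` without creating a forbidden pattern. -/
def IsActiveSite {n : ℕ} (ρ : Equiv.Perm (Fin n)) (p : ℕ) : Prop :=
  ∀ u v : Fin n, (v : ℕ) = u + 1 → ρ v < ρ u → p ≠ ρ v + 1

instance {n : ℕ} (ρ : Equiv.Perm (Fin n)) : DecidablePred (IsActiveSite ρ) :=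
  fun p => inferInstanceAs (Decidable (∀ u v : Fin n, (v : ℕ) = u + 1 → ρ v < ρ u → p ≠ ρ v + 1))

theorem val_succAbove {n : ℕ} (p : Fin (n + 1)) (i : Fin n) :
    (p.succAbove i : ℕ) = if (i : ℕ) < p then (i : ℕ) else i + 1 := by
  grind [Fin.succAbove]

theorem isRInv_insertMax {n : ℕ} (p : Fin (n + 1)) (ρ : Equiv.Perm (Fin n)) :
    IsRInv (insertMax p ρ) ↔ IsRInv ρ ∧ IsActiveSite ρ p := by
  simp only [IsRInv, IsActiveSite, Fin.forall_fin_succ', insertMax_castSucc, insertMax_last,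
    Fin.lt_def, val_succAbove, Fin.val_castSucc, Fin.val_last]
  grind [val_apply_ne]

theorem isActiveSite_insertMax_iff {n : ℕ} (ρ : Equiv.Perm (Fin n)) {p : Fin (n + 1)} {q : ℕ}
    (hq : q ≤ p) : IsActiveSite (insertMax p ρ) q ↔ IsActiveSite ρ q := by
  simp only [IsActiveSite, Fin.forall_fin_succ', insertMax_castSucc, insertMax_last,
    Fin.lt_def, val_succAbove, Fin.val_castSucc, Fin.val_last]
  grind

theorem count_isActiveSite {n : ℕ} (ρ : Equiv.Perm (Fin (n + 1))) :
    Nat.count (IsActiveSite ρ) (n + 2) = asc (fun i => (ρ i : ℕ)) + 2 := by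
  have hzero : IsActiveSite ρ 0 := fun _ _ _ _ => (Nat.succ_ne_zero _).symm
  have hfirst : IsActiveSite ρ (ρ 0 + 1) := fun u v huv _ h => by
    have : (0 : Fin (n + 1)) = v := ρ.injective (Fin.ext (Nat.succ_injective h))
    simp [← this] at huv
  have hsucc (j : Fin n) : IsActiveSite ρ (ρ j.succ + 1) ↔ (ρ j.castSucc : ℕ) < ρ j.succ := by
    have hne := val_apply_ne ρ j.castSucc_lt_succ.ne
    refine ⟨fun h => ?_, fun h u v huv hlt hv => ?_⟩
    · have := h j.castSucc j.succ (by simp)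
      grind
    · obtain rfl : j.succ = v := ρ.injective (Fin.ext (Nat.succ_injective hv))
      obtain rfl : j.castSucc = u := Fin.ext (by simpa using huv)
      exact h.not_gt hlt
  rw [Nat.count_succ', if_pos hzero, Nat.count_eq_card_filter_range, card_filter,
    ← Fin.sum_univ_eq_sum_range fun i => if IsActiveSite ρ (i + 1) then 1 else 0,
    ← Equiv.sum_comp ρ, Fin.sum_univ_succ, if_pos hfirst, asc_eq_sum]
  simp only [hsucc]
  ring

/-- The active sites, numbered from left to right. -/
noncomputable def siteEquiv {n : ℕ} (ρ : Equiv.Perm (Fin (n + 1))) :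
    {p : Fin (n + 2) // IsActiveSite ρ p} ≃ Fin (asc (fun i => (ρ i : ℕ)) + 2) :=
  (countEquiv _ _).trans (finCongr (count_isActiveSite ρ))

theorem val_siteEquiv {n : ℕ} (ρ : Equiv.Perm (Fin (n + 1)))
    (p : {p : Fin (n + 2) // IsActiveSite ρ p}) :
    (siteEquiv ρ p : ℕ) = Nat.count (IsActiveSite ρ) p :=
  rfl

/-- Insertion of a new largest entry at an active site reaches every permutation satisfying `IsRInv`
exactly once. -/
noncomputable def insertMaxEquiv (n : ℕ) :
    (Σ ρ : {ρ : Equiv.Perm (Fin n) // IsRInv ρ}, {p : Fin (n + 1) // IsActiveSite ρ.1 p}) ≃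
      {ρ : Equiv.Perm (Fin (n + 1)) // IsRInv ρ} :=
  Equiv.ofBijective
    (fun x => ⟨insertMax x.2.1 x.1.1, (isRInv_insertMax _ _).2 ⟨x.1.2, x.2.2⟩⟩) <| by
    constructor
    · rintro ⟨⟨ρ, hρ⟩, ⟨p, hp⟩⟩ ⟨⟨ρ', hρ'⟩, ⟨p', hp'⟩⟩ h
      obtain ⟨rfl, rfl⟩ := Prod.mk.injEq .. ▸ (insertMax_bijective n).1 (a₁ := (ρ, p))
        (a₂ := (ρ', p')) (congrArg Subtype.val h)
      rfl
    · rintro ⟨ρ', hρ'⟩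
      obtain ⟨⟨ρ, p⟩, rfl⟩ := (insertMax_bijective n).2 ρ'
      obtain ⟨h, hp⟩ := (isRInv_insertMax _ _).1 hρ'
      exact ⟨⟨⟨ρ, h⟩, ⟨p, hp⟩⟩, rfl⟩

theorem val_insertMaxEquiv {n : ℕ} (ρ : {ρ : Equiv.Perm (Fin n) // IsRInv ρ})
    (p : {p : Fin (n + 1) // IsActiveSite ρ.1 p}) :
    (insertMaxEquiv n ⟨ρ, p⟩).1 = insertMax p.1 ρ.1 :=
  rfl

theorem IsRInv.isActiveSite_last {n : ℕ} {ρ : Equiv.Perm (Fin (n + 1))} (h : IsRInv ρ) :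
    IsActiveSite ρ (ρ (Fin.last n)) :=
  fun u v huv hlt hv => (h u v _ huv hlt hv).not_ge v.le_last

theorem asc_insertMax {n : ℕ} (p : Fin (n + 2)) (ρ : Equiv.Perm (Fin (n + 1))) :
    asc (fun i => (insertMax p ρ i : ℕ)) =
      asc (fun i => (ρ i : ℕ)) + if (ρ (Fin.last n) : ℕ) < p then 1 else 0 := by
  rw [asc_succ, asc_eq_sum, asc_eq_sum]
  simp only [Fin.init, insertMax_castSucc, insertMax_last, val_succAbove]
  grind

instance {n : ℕ} [Subsingleton (Fin n)] : Unique {ρ : Equiv.Perm (Fin n) // IsRInv ρ} where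
  default := ⟨1, fun u v _ h => by simp [Subsingleton.elim u v] at h⟩
  uniq _ := Subtype.ext (Subsingleton.elim _ _)

/-- The permutations satisfying `IsRInv` grow by inserting a new largest entry. -/
noncomputable def permTree : AscentTree fun n => {ρ : Equiv.Perm (Fin (n + 1)) // IsRInv ρ} where
  asc ρ := asc fun i => (ρ.1 i : ℕ)
  last ρ := Nat.count (IsActiveSite ρ.1) (ρ.1 (Fin.last _))
  root := inferInstanceAs (Unique {ρ : Equiv.Perm (Fin 1) // IsRInv ρ})
  asc_root := by simp [asc_eq_sum]
  last_root := by simp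
  child n := (Equiv.sigmaCongrRight fun ρ : {ρ : Equiv.Perm (Fin (n + 1)) // IsRInv ρ} =>
    (siteEquiv ρ.1).symm).trans (insertMaxEquiv (n + 1))
  last_child ρ j := by
    obtain ⟨p, rfl⟩ := (siteEquiv ρ.1).surjective j
    simp only [Equiv.trans_apply, Equiv.sigmaCongrRight_apply,
      Equiv.symm_apply_apply, val_insertMaxEquiv, insertMax_last, val_siteEquiv]
    exact count_congr fun q hq => isActiveSite_insertMax_iff ρ.1 hq.le
  asc_child ρ j := by
    obtain ⟨p, rfl⟩ := (siteEquiv ρ.1).surjective j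
    have hlt : (ρ.1 (Fin.last _) : ℕ) < p.1 ↔ Nat.count (IsActiveSite ρ.1) (ρ.1 (Fin.last _)) <
        Nat.count (IsActiveSite ρ.1) p.1 :=
      ⟨Nat.count_strict_mono ρ.2.isActiveSite_last, Nat.lt_of_count_lt_count⟩
    simp only [Equiv.trans_apply, Equiv.sigmaCongrRight_apply,
      Equiv.symm_apply_apply, val_insertMaxEquiv, asc_insertMax, val_siteEquiv, hlt]
    grind

theorem permSeries_eq : permSeries = 1 + X * treeSeries 0 0 := by
  have hinv (n : ℕ) : Nat.card {π : Equiv.Perm (Fin n) // IsR π} =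
      Nat.card {ρ : Equiv.Perm (Fin n) // IsRInv ρ} :=
    Nat.card_congr ((Equiv.inv (Equiv.Perm (Fin n))).subtypeEquiv fun π => isR_iff_isRInv_symm π)
  simp only [permSeries, hinv]
  exact permTree.mk_card_eq (Y := fun n => {ρ : Equiv.Perm (Fin n) // IsRInv ρ})

/-! ### Interval systems -/

/-- `A` is a set of intervals `[i, j]` with `0 ≤ i ≤ j < m`, encoded as pairs `(i, j)`, such that
each `k < m` is a left endpoint and a right endpoint. -/
structure IsIntervalSet (A : Set (ℕ × ℕ)) (m : ℕ) : Prop where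
  fst_le_snd {x} : x ∈ A → x.1 ≤ x.2
  image_fst : Prod.fst '' A = Set.Iio m
  image_snd : Prod.snd '' A = Set.Iio m

namespace IsIntervalSet

variable {A : Set (ℕ × ℕ)} {m m' : ℕ}

theorem fst_lt (h : IsIntervalSet A m) {x : ℕ × ℕ} (hx : x ∈ A) : x.1 < m :=
  h.image_fst.subset ⟨x, hx, rfl⟩

theorem snd_lt (h : IsIntervalSet A m) {x : ℕ × ℕ} (hx : x ∈ A) : x.2 < m :=
  h.image_snd.subset ⟨x, hx, rfl⟩

theorem unique (h : IsIntervalSet A m) (h' : IsIntervalSet A m') : m = m' :=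
  Set.Iio_injective (h.image_fst.symm.trans h'.image_fst)

end IsIntervalSet

/-- The multisets of `n` intervals with endpoint set `{0, …, m - 1}` for some `m`; these encode the
Fishburn matrices, upper triangular matrices of natural numbers without zero rows or columns. -/
def IntervalMultiset (n : ℕ) : Type :=
  {s : Sym (ℕ × ℕ) n // ∃ m, IsIntervalSet {x | x ∈ s} m}

/-- The intervals with left endpoint in `I` and right endpoint in `J`. -/
def intervals (I J : Finset ℕ) : Finset (ℕ × ℕ) := {x ∈ I ×ˢ J | x.1 ≤ x.2}

theorem card_intervals (I J : Finset ℕ) : #(intervals I J) = ∑ j ∈ J, #{i ∈ I | i ≤ j} := by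
  rw [intervals, card_filter, sum_product_right]
  simp only [card_filter]

/-- The finite set of left endpoints of a multiset of intervals. -/
def fstImage {n : ℕ} (s : Sym (ℕ × ℕ) n) : Finset ℕ :=
  (s : Multiset (ℕ × ℕ)).toFinset.image Prod.fst

/-- The finite set of right endpoints of a multiset of intervals. -/
def sndImage {n : ℕ} (s : Sym (ℕ × ℕ) n) : Finset ℕ :=
  (s : Multiset (ℕ × ℕ)).toFinset.image Prod.snd

theorem isIntervalSet_sym_iff {n m : ℕ} (s : Sym (ℕ × ℕ) n) :
    IsIntervalSet {x | x ∈ s} m ↔ s ∈ (intervals (range m) (range m)).sym n ∧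
      range m ⊆ fstImage s ∧ range m ⊆ sndImage s := by
  simp only [fstImage, sndImage, mem_sym_iff, intervals, mem_filter, mem_product, mem_range,
    subset_iff, mem_image, Multiset.mem_toFinset, Sym.mem_coe]
  constructor
  · exact fun h => ⟨fun x hx => ⟨⟨h.fst_lt hx, h.snd_lt hx⟩, h.fst_le_snd hx⟩,
      fun i hi => h.image_fst.superset hi, fun i hi => h.image_snd.superset hi⟩
  · rintro ⟨hmem, hfst, hsnd⟩
    refine ⟨fun hx => (hmem _ hx).2, Set.Subset.antisymm ?_ fun i => @hfst i,
      Set.Subset.antisymm ?_ fun i => @hsnd i⟩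
    · rintro _ ⟨x, hx, rfl⟩
      exact (hmem x hx).1.1
    · rintro _ ⟨x, hx, rfl⟩
      exact (hmem x hx).1.2

theorem IsIntervalSet.le_card {n m : ℕ} {s : Sym (ℕ × ℕ) n} (h : IsIntervalSet {x | x ∈ s} m) :
    m ≤ n := by
  calc m = #(range m) := (card_range m).symm
    _ ≤ #(fstImage s) := card_le_card ((isIntervalSet_sym_iff s).1 h).2.1
    _ ≤ #(s : Multiset (ℕ × ℕ)).toFinset := card_image_le
    _ ≤ (s : Multiset (ℕ × ℕ)).card := Multiset.toFinset_card_le _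
    _ = n := s.card_coe

/-! ### Counting interval systems -/

theorem coeff_geomSeries_pow_card {α : Type*} [DecidableEq α] (T : Finset α) (n : ℕ) :
    coeff n (geomSeries ℤ ^ #T) = #(T.sym n) := by
  induction T using Finset.induction_on generalizing n with
  | empty => cases n <;> simp [coeff_one]
  | insert a T ha ih =>
    have hcard : #((insert a T).sym n) = ∑ i : Fin (n + 1), #(T.sym (n - i)) := by
      simpa using Fintype.card_congr (symInsertEquiv (n := n) ha)
    rw [card_insert_of_notMem ha, pow_succ', coeff_mul,
      Nat.sum_antidiagonal_eq_sum_range_succ_mk, hcard,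
      Fin.sum_univ_eq_sum_range (fun i => #(T.sym (n - i))) (n + 1), Nat.cast_sum]
    have hcoeff (k : ℕ) : coeff k (geomSeries ℤ) = 1 := coeff_mk k _
    simp only [hcoeff, one_mul, ih]

theorem card_filter_subset {α β : Type*} [DecidableEq α] (B : Finset β) (f : β → Finset α)
    (I : Finset α) :
    (#{s ∈ B | I ⊆ f s} : ℤ) = ∑ S ∈ I.powerset, (-1) ^ #S * (#{s ∈ B | Disjoint S (f s)} : ℤ) := by
  have hfilter (s : β) : {S ∈ I.powerset | Disjoint S (f s)} = (I \ f s).powerset := by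
    ext S
    simp [subset_sdiff]
  simp only [card_filter, Nat.cast_sum, mul_sum]
  rw [sum_comm]
  refine sum_congr rfl fun s _ => ?_
  simp [← sum_filter, hfilter, sum_powerset_neg_one_pow_card, sdiff_eq_empty_iff_subset]

theorem sum_powerset_neg_one_pow_mul_prod_sdiff {α R : Type*} [DecidableEq α] [CommRing R]
    (I : Finset α) (f : α → R) :
    ∑ S ∈ I.powerset, (-1) ^ #S * ∏ j ∈ I \ S, f j = ∏ j ∈ I, (f j - 1) := by
  simp_rw [sub_eq_neg_add, prod_add, prod_const]

theorem sum_sum_geomSeries_pow_card_intervals (R : Type*) [CommRing R] (m : ℕ) :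
    ∑ S ∈ (range m).powerset, ∑ S' ∈ (range m).powerset,
      (-1) ^ #S * ((-1) ^ #S' * geomSeries R ^ #(intervals (range m \ S) (range m \ S'))) =
      sieveSum (geomSeries R) m 0 := by
  have hcard {S : Finset ℕ} {j : ℕ} (hj : j ∈ range m) :
      #{i ∈ range m \ S | i ≤ j} = #(Icc 0 j \ S) := by
    congr 1
    grind
  have hsieve := sieveSum_eq_sum_powerset (geomSeries R) m.zero_le 0
  simp only [Nat.sub_zero, zero_add, ← range_eq_Ico] at hsieve
  rw [hsieve]
  refine sum_congr rfl fun S _ => ?_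
  simp only [← mul_sum, card_intervals, ← prod_pow_eq_pow_sum,
    sum_powerset_neg_one_pow_mul_prod_sdiff]
  exact congrArg _ (prod_congr rfl fun j hj => by rw [hcard hj])

/-- The multisets of `n` intervals whose sets of left and of right endpoints are `{0, …, m - 1}`. -/
def intervalMultisets (n m : ℕ) : Finset (Sym (ℕ × ℕ) n) :=
  {s ∈ (intervals (range m) (range m)).sym n |
    range m ⊆ fstImage s ∧ range m ⊆ sndImage s}

theorem mem_intervalMultisets {n m : ℕ} {s : Sym (ℕ × ℕ) n} :
    s ∈ intervalMultisets n m ↔ IsIntervalSet {x | x ∈ s} m := by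
  rw [isIntervalSet_sym_iff, intervalMultisets, mem_filter]

theorem card_intervalMultisets (n m : ℕ) :
    (#(intervalMultisets n m) : ℤ) = coeff n (sieveSum (geomSeries ℤ) m 0) := by
  have havoid (S S' : Finset ℕ) :
      {s ∈ {s ∈ (intervals (range m) (range m)).sym n | Disjoint S (fstImage s)} |
        Disjoint S' (sndImage s)} = (intervals (range m \ S) (range m \ S')).sym n := by
    ext s
    rw [mem_filter, mem_filter]
    simp only [mem_filter, mem_sym_iff, intervals, disjoint_right, mem_image, mem_product,
      Multiset.mem_toFinset, Sym.mem_coe, mem_sdiff, fstImage, sndImage]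
    grind
  have hsign (k : ℕ) (f : ℤ⟦X⟧) : coeff n ((-1) ^ k * f) = (-1) ^ k * coeff n f := by
    rw [show (-1 : ℤ⟦X⟧) ^ k = C ((-1) ^ k) by simp, coeff_C_mul]
  rw [intervalMultisets, ← filter_filter, filter_comm, card_filter_subset,
    ← sum_sum_geomSeries_pow_card_intervals, map_sum]
  refine sum_congr rfl fun S _ => ?_
  rw [filter_comm, card_filter_subset, map_sum, mul_sum]
  refine sum_congr rfl fun S' _ => ?_
  rw [havoid, hsign, hsign, coeff_geomSeries_pow_card]

/-- The generating function of interval multisets by the number of intervals. -/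
noncomputable def intervalSeries : ℤ⟦X⟧ :=
  PowerSeries.mk fun n => (Nat.card (IntervalMultiset n) : ℤ)

theorem coeff_intervalSeries (n : ℕ) :
    coeff n intervalSeries = ∑ m ∈ range (n + 1), coeff n (sieveSum (geomSeries ℤ) m 0) := by
  have hdisj : (range (n + 1) : Set ℕ).PairwiseDisjoint (intervalMultisets n) :=
    fun m _ m' _ hne => disjoint_left.2 fun s h h' =>
      hne ((mem_intervalMultisets.1 h).unique (mem_intervalMultisets.1 h'))
  have hmem (s : Sym (ℕ × ℕ) n) : s ∈ (range (n + 1)).biUnion (intervalMultisets n) ↔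
      ∃ m, IsIntervalSet {x | x ∈ s} m := by
    simp only [mem_biUnion, mem_range, Nat.lt_succ_iff, mem_intervalMultisets]
    exact exists_congr fun m => and_iff_right_of_imp IsIntervalSet.le_card
  rw [intervalSeries, coeff_mk, IntervalMultiset, Nat.subtype_card _ hmem, card_biUnion hdisj,
    Nat.cast_sum]
  simp only [card_intervalMultisets]

/-- The unit `1 - X` of `ℤ⟦X⟧`. -/
noncomputable def oneSubX : ℤ⟦X⟧ˣ where
  val := 1 - X
  inv := geomSeries ℤ
  val_inv := (mul_comm _ _).trans geomSeries_mul
  inv_val := geomSeries_mul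

theorem X_pow_dvd_intervalSeries_sub (N : ℕ) :
    (X : ℤ⟦X⟧) ^ N ∣ intervalSeries - ∑ k ∈ range N, qPoch (1 - X) k := by
  have hX : (1 - oneSubX : ℤ⟦X⟧) = X := sub_sub_cancel 1 X
  have hdvd (m : ℕ) := one_sub_pow_dvd_sieveSum oneSubX m 0
  have h := one_sub_pow_dvd_sum_sieveSum_sub_sum_qPoch oneSubX N
  rw [hX] at h
  simp only [hX, X_pow_dvd_iff] at hdvd
  rw [← sub_add_sub_cancel _ (∑ m ∈ range N, sieveSum (geomSeries ℤ) m 0)]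
  refine dvd_add (X_pow_dvd_iff.2 fun n hn => ?_) h
  rw [map_sub, map_sum, coeff_intervalSeries, sub_eq_zero]
  refine sum_subset (range_subset_range.2 hn) fun m _ hm => hdvd m n (by grind)

/-! ### Multisets as families up to permutation -/

section SymOf

variable {n : ℕ} {β : Type*}

/-- The multiset of values of a finite family. -/
def symOf (f : Fin n → β) : Sym β n :=
  ⟨univ.val.map f, by simp⟩

theorem setOf_mem_symOf (f : Fin n → β) : {x | x ∈ symOf f} = Set.range f := by
  ext x
  simp [symOf]

theorem symOf_surjective : Function.Surjective (symOf : (Fin n → β) → Sym β n) := by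
  rintro ⟨⟨L⟩, hL⟩
  subst hL
  exact ⟨L.get, Subtype.ext ((Fin.univ_val_map _).trans (congrArg _ (List.ofFn_get L)))⟩

theorem symOf_eq_iff {f g : Fin n → β} :
    symOf f = symOf g ↔ ∃ e : Equiv.Perm (Fin n), f = g ∘ e := by
  classical
  rw [← Sym.coe_inj]
  constructor
  · intro h
    have hfiber (b : β) : Nonempty ({i // f i = b} ≃ {i // g i = b}) := by
      have hb := congrArg (Multiset.count b) h
      simp only [symOf, Sym.coe_mk, Multiset.count_map, ← filter_val, ← card_def] at hb
      rw [← Fintype.card_eq, Fintype.card_subtype, Fintype.card_subtype]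
      simpa only [eq_comm] using hb
    exact ⟨Equiv.ofFiberEquiv fun b => (hfiber b).some,
      funext fun i => (Equiv.ofFiberEquiv_map _ i).symm⟩
  · rintro ⟨e, rfl⟩
    simp only [symOf, Sym.coe_mk, ← Multiset.map_map, Multiset.map_univ_val_equiv]

end SymOf

/-! ### Interval representations -/

/-- `p` represents the strict order `lt` by intervals: `x` is below `y` if and only if the interval
of `x` lies entirely to the left of that of `y`. -/
structure IsRep {α : Type*} (lt : α → α → Prop) (p : α → ℕ × ℕ) : Prop where
  exists_isIntervalSet : ∃ m, IsIntervalSet (Set.range p) m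
  lt_iff (x y) : lt x y ↔ (p x).2 < (p y).1

theorem le_of_forall_lt_imp_lt {α : Type*} {f g : α → ℕ} (hf : IsLowerSet (Set.range f))
    (h : ∀ x y, f x < f y → g x < g y) : f ≤ g := by
  intro x
  induction hx : f x generalizing x with
  | zero => exact Nat.zero_le _
  | succ k ih =>
    obtain ⟨y, hy⟩ := hf (Nat.le_succ k) ⟨x, hx⟩
    exact Nat.succ_le_of_lt ((ih y hy).trans_lt (h y x (by lia)))

namespace IsRep

variable {α : Type*} {lt : α → α → Prop} {p p' : α → ℕ × ℕ}

theorem comp_equiv {β : Type*} (h : IsRep lt p) (e : β ≃ α) :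
    IsRep (fun x y => lt (e x) (e y)) (p ∘ e) where
  exists_isIntervalSet := by simpa only [e.surjective.range_comp] using h.exists_isIntervalSet
  lt_iff x y := h.lt_iff (e x) (e y)

theorem exists_range (h : IsRep lt p) : ∃ m, Set.range (fun x => (p x).1) = Set.Iio m ∧
    Set.range (fun x => (p x).2) = Set.Iio m := by
  obtain ⟨m, hm⟩ := h.exists_isIntervalSet
  exact ⟨m, (Set.range_comp _ _).trans hm.image_fst, (Set.range_comp _ _).trans hm.image_snd⟩

theorem isLowerSet_range_fst (h : IsRep lt p) : IsLowerSet (Set.range fun x => (p x).1) := by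
  obtain ⟨m, hm, -⟩ := h.exists_range
  exact hm ▸ isLowerSet_Iio m

theorem exists_fst_eq_snd (h : IsRep lt p) (x : α) : ∃ y, (p y).1 = (p x).2 := by
  obtain ⟨m, hfst, hsnd⟩ := h.exists_range
  exact (hsnd.trans hfst.symm).subset ⟨x, rfl⟩

theorem exists_snd_eq_fst (h : IsRep lt p) (x : α) : ∃ y, (p y).2 = (p x).1 := by
  obtain ⟨m, hfst, hsnd⟩ := h.exists_range
  exact (hfst.trans hsnd.symm).subset ⟨x, rfl⟩

theorem fst_lt_fst_iff (h : IsRep lt p) (x y : α) :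
    (p x).1 < (p y).1 ↔ ∃ z, lt z y ∧ ¬ lt z x := by
  simp only [h.lt_iff, not_lt]
  constructor
  · obtain ⟨z, hz⟩ := h.exists_snd_eq_fst x
    exact fun hxy => ⟨z, hz.trans_lt hxy, hz.ge⟩
  · rintro ⟨z, hzy, hzx⟩
    exact hzx.trans_lt hzy

theorem fst_le_fst (h : IsRep lt p) (h' : IsRep lt p') (x : α) : (p x).1 ≤ (p' x).1 :=
  le_of_forall_lt_imp_lt h.isLowerSet_range_fst
    (fun x y hxy => (h'.fst_lt_fst_iff x y).2 ((h.fst_lt_fst_iff x y).1 hxy)) x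

theorem snd_le_snd (h : IsRep lt p) (h' : IsRep lt p') (x : α) : (p x).2 ≤ (p' x).2 := by
  obtain ⟨y, hy⟩ := h.exists_fst_eq_snd x
  have hxy : (p' y).1 ≤ (p' x).2 := by
    rw [← not_lt, ← h'.lt_iff, h.lt_iff, hy]
    exact lt_irrefl _
  exact hy.ge.trans ((h.fst_le_fst h' y).trans hxy)

theorem unique (h : IsRep lt p) (h' : IsRep lt p') : p = p' :=
  funext fun x => Prod.ext ((h.fst_le_fst h' x).antisymm (h'.fst_le_fst h x))
    ((h.snd_le_snd h' x).antisymm (h'.snd_le_snd h x))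

theorem symOf_eq_iff_nonempty_relIso {n : ℕ} {lt lt' : Fin n → Fin n → Prop} {p p' : Fin n → ℕ × ℕ}
    (h : IsRep lt p) (h' : IsRep lt' p') : symOf p = symOf p' ↔ Nonempty (lt ≃r lt') := by
  rw [symOf_eq_iff]
  constructor
  · rintro ⟨e, rfl⟩
    exact ⟨⟨e, fun {x y} => (h'.lt_iff _ _).trans (h.lt_iff x y).symm⟩⟩
  · rintro ⟨e⟩
    refine ⟨e.toEquiv, h.unique ⟨(h'.comp_equiv e.toEquiv).exists_isIntervalSet, fun x y => ?_⟩⟩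
    exact e.map_rel_iff.symm.trans (h'.lt_iff _ _)

end IsRep

section CanonicalRep

variable {α : Type*} [PartialOrder α]

theorem TwoPlusTwoFree.lt_or_lt (h : TwoPlusTwoFree α) {a x b y : α} (hax : a < x) (hby : b < y) :
    a < y ∨ b < x := by
  by_contra! hcon
  obtain ⟨hay, hbx⟩ := hcon
  have hay' : ¬ a ≤ y := fun hle => hle.lt_or_eq.elim hay fun heq => hbx ((heq ▸ hby).trans hax)
  have hbx' : ¬ b ≤ x := fun hle => hle.lt_or_eq.elim hbx fun heq => hay ((heq ▸ hax).trans hby)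
  have hmap (u v : Fin 2 ⊕ Fin 2) :
      Sum.elim ![a, x] ![b, y] u ≤ Sum.elim ![a, x] ![b, y] v ↔ u ≤ v := by
    rcases u with u | u <;> rcases v with v | v <;> fin_cases u <;> fin_cases v <;> simp <;> grind
  exact h.elim (OrderEmbedding.ofMapLEIff _ hmap)

theorem TwoPlusTwoFree.Iio_total (h : TwoPlusTwoFree α) (x y : α) :
    Set.Iio x ⊆ Set.Iio y ∨ Set.Iio y ⊆ Set.Iio x := by
  by_contra! hcon
  obtain ⟨⟨a, hax, hay⟩, b, hby, hbx⟩ := hcon.imp Set.not_subset.1 Set.not_subset.1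
  exact (h.lt_or_lt hax hby).elim hay hbx

/-- The number of elements below `x`. -/
noncomputable def downCard (x : α) : ℕ := (Set.Iio x).ncard

open Classical in
/-- The left endpoint of `x` in the canonical representation: the number of cardinalities of
down-sets `Iio y` that are less than that of `Iio x`. -/
noncomputable def leftEnd (x : α) : ℕ :=
  Nat.count (· ∈ Set.range (downCard : α → ℕ)) (downCard x)

/-- The right endpoint of `x` in the canonical representation. -/
noncomputable def rightEnd (x : α) : ℕ := ⨆ y : {y // ¬ x < y}, leftEnd y.1

theorem leftEnd_lt_iff {x y : α} : leftEnd x < leftEnd y ↔ downCard x < downCard y := by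
  classical
  exact ⟨fun h => lt_of_not_ge fun hxy => h.not_ge (Nat.count_monotone _ hxy),
    Nat.count_strict_mono ⟨x, rfl⟩⟩

variable [Finite α]

theorem TwoPlusTwoFree.Iio_subset (h : TwoPlusTwoFree α) {x y : α}
    (hxy : downCard x ≤ downCard y) : Set.Iio x ⊆ Set.Iio y :=
  (h.Iio_total x y).elim id fun hsub => (Set.eq_of_subset_of_ncard_le hsub hxy).ge

theorem exists_range_leftEnd (α : Type*) [PartialOrder α] [Finite α] :
    ∃ m, Set.range (leftEnd : α → ℕ) = Set.Iio m := by
  classical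
  refine ⟨Nat.count (· ∈ Set.range (downCard : α → ℕ)) (Nat.card α), Set.Subset.antisymm ?_ ?_⟩
  · rintro _ ⟨x, rfl⟩
    have hx : downCard x < Nat.card α := by
      rw [← Set.ncard_univ]
      exact Set.ncard_lt_ncard (Set.ssubset_univ_iff.2 fun h => lt_irrefl x (h.ge trivial))
    exact Nat.count_strict_mono ⟨x, rfl⟩ hx
  · intro i hi
    obtain ⟨_, -, ⟨x, rfl⟩, hx⟩ := exists_count_eq_of_lt hi
    exact ⟨x, hx⟩

theorem leftEnd_le_rightEnd {x y : α} (h : ¬ x < y) : leftEnd y ≤ rightEnd x :=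
  le_ciSup (f := fun y : {y // ¬ x < y} => leftEnd y.1) (Set.finite_range _).bddAbove ⟨y, h⟩

theorem exists_leftEnd_eq_rightEnd (x : α) : ∃ y, ¬ x < y ∧ leftEnd y = rightEnd x := by
  have : Nonempty {y // ¬ x < y} := ⟨⟨x, lt_irrefl x⟩⟩
  obtain ⟨⟨y, hxy⟩, hy⟩ := exists_eq_ciSup_of_finite (f := fun y : {y // ¬ x < y} => leftEnd y.1)
  exact ⟨y, hxy, hy⟩

theorem TwoPlusTwoFree.lt_iff (h : TwoPlusTwoFree α) (x y : α) :
    x < y ↔ rightEnd x < leftEnd y := by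
  refine ⟨fun hxy => ?_, fun hxy => not_not.1 fun hnot => hxy.not_ge (leftEnd_le_rightEnd hnot)⟩
  obtain ⟨z, hxz, hz⟩ := exists_leftEnd_eq_rightEnd x
  rw [← hz, leftEnd_lt_iff]
  exact lt_of_not_ge fun hyz => hxz (h.Iio_subset hyz hxy)

theorem TwoPlusTwoFree.range_rightEnd (h : TwoPlusTwoFree α) :
    Set.range (rightEnd : α → ℕ) = Set.range (leftEnd : α → ℕ) := by
  obtain ⟨m, hm⟩ := exists_range_leftEnd α
  refine Set.Subset.antisymm ?_ ?_
  · rintro _ ⟨x, rfl⟩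
    obtain ⟨y, -, hy⟩ := exists_leftEnd_eq_rightEnd x
    exact ⟨y, hy⟩
  rintro _ ⟨y, rfl⟩
  by_cases hnext : leftEnd y + 1 < m
  · obtain ⟨y', hy'⟩ := hm.superset hnext
    have hcard : downCard y < downCard y' := leftEnd_lt_iff.1 (by lia)
    obtain ⟨x, hxy', hxy⟩ := Set.exists_mem_notMem_of_ncard_lt_ncard hcard
    refine ⟨x, (Nat.lt_succ_iff.1 ?_).antisymm (leftEnd_le_rightEnd hxy)⟩
    exact ((h.lt_iff x y').1 hxy').trans_eq hy'
  · obtain ⟨z, -, hz⟩ := exists_leftEnd_eq_rightEnd y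
    have hzm : leftEnd z < m := hm.subset ⟨z, rfl⟩
    have hle := leftEnd_le_rightEnd (lt_irrefl y)
    exact ⟨y, by lia⟩

theorem TwoPlusTwoFree.isRep (h : TwoPlusTwoFree α) :
    IsRep (fun x y : α => x < y) fun x => (leftEnd x, rightEnd x) where
  exists_isIntervalSet := by
    obtain ⟨m, hm⟩ := exists_range_leftEnd α
    refine ⟨m, ⟨?_, ?_, ?_⟩⟩
    · rintro _ ⟨x, rfl⟩
      exact leftEnd_le_rightEnd (lt_irrefl x)
    · rw [← Set.range_comp]
      exact hm
    · rw [← Set.range_comp]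
      exact h.range_rightEnd.trans hm
  lt_iff := h.lt_iff

end CanonicalRep

section LabeledPoset

variable {n : ℕ}

/-- The order on the index set of a family of intervals in which `x` is below `y` if its interval
lies entirely to the left of that of `y`. -/
@[reducible] def intervalOrder (p : Fin n → ℕ × ℕ) (hp : ∀ i, (p i).1 ≤ (p i).2) :
    PartialOrder (Fin n) where
  le x y := x = y ∨ (p x).2 < (p y).1
  lt x y := (p x).2 < (p y).1
  le_refl x := Or.inl rfl
  le_trans x y z := by grind
  lt_iff_le_not_ge x y := by grind
  le_antisymm x y := by grind

theorem twoPlusTwoFree_intervalOrder (p : Fin n → ℕ × ℕ) (hp : ∀ i, (p i).1 ≤ (p i).2) :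
    @TwoPlusTwoFree (Fin n) (intervalOrder p hp) := by
  let _ := intervalOrder p hp
  refine ⟨fun f => ?_⟩
  have hlt (u v : Fin 2 ⊕ Fin 2) : (p (f u)).2 < (p (f v)).1 ↔ u < v := f.lt_iff_lt
  have hl := (hlt (.inl 0) (.inl 1)).2 (by simp)
  have hr := (hlt (.inr 0) (.inr 1)).2 (by simp)
  have hlr := (hlt (.inl 0) (.inr 1)).not.2 (by simp)
  have hrl := (hlt (.inr 0) (.inl 1)).not.2 (by simp)
  lia

/-- The canonical representation of a labeled poset. -/
noncomputable def LabeledPoset.rep (P : LabeledPoset n) : Fin n → ℕ × ℕ :=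
  let _ := P.1
  fun x => (leftEnd x, rightEnd x)

theorem LabeledPoset.isRep (P : LabeledPoset n) : IsRep P.1.lt P.rep :=
  @TwoPlusTwoFree.isRep _ P.1 _ P.2

/-- The multiset of intervals of the canonical representation. -/
noncomputable def LabeledPoset.intervals (P : LabeledPoset n) : IntervalMultiset n :=
  ⟨symOf P.rep, by simpa only [setOf_mem_symOf] using P.isRep.exists_isIntervalSet⟩

theorem LabeledPoset.intervals_eq_iff (P Q : LabeledPoset n) :
    P.intervals = Q.intervals ↔ Nonempty (P.1.le ≃r Q.1.le) := by
  refine Subtype.ext_iff.trans ((P.isRep.symOf_eq_iff_nonempty_relIso Q.isRep).trans ⟨?_, ?_⟩)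
  · exact fun ⟨e⟩ => ⟨@OrderIso.ofRelIsoLT _ _ P.1 Q.1 e⟩
  · exact fun ⟨e⟩ => ⟨@OrderIso.toRelIsoLT _ _ P.1.toPreorder Q.1.toPreorder e⟩

theorem LabeledPoset.intervals_surjective :
    Function.Surjective (LabeledPoset.intervals : LabeledPoset n → IntervalMultiset n) := by
  rintro ⟨s, m, hm⟩
  obtain ⟨p, rfl⟩ := symOf_surjective s
  rw [setOf_mem_symOf] at hm
  have hp (i : Fin n) : (p i).1 ≤ (p i).2 := hm.fst_le_snd ⟨i, rfl⟩
  let P : LabeledPoset n := ⟨intervalOrder p hp, twoPlusTwoFree_intervalOrder p hp⟩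
  have hrep : IsRep P.1.lt p := ⟨⟨m, hm⟩, fun x y => Iff.rfl⟩
  exact ⟨P, Subtype.ext (congrArg symOf (P.isRep.unique hrep))⟩

theorem card_unlabeledPoset (n : ℕ) :
    Nat.card (UnlabeledPoset n) = Nat.card (IntervalMultiset n) := by
  refine Nat.card_congr (Equiv.ofBijective
    (Quotient.lift LabeledPoset.intervals fun P Q => (P.intervals_eq_iff Q).2) ⟨?_, ?_⟩)
  · rintro ⟨P⟩ ⟨Q⟩ h
    exact Quotient.sound ((P.intervals_eq_iff Q).1 h)
  · exact (Quotient.lift_surjective_iff _ _).2 LabeledPoset.intervals_surjective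

end LabeledPoset

/-! ### Runs of a chord diagram -/

section Runs

variable {N : ℕ} {π : Equiv.Perm (Fin N)}

/-- Position `k` closes a chord and is not followed by another such position. The turns cut a chord
diagram into runs, each of them consisting of openers followed by closers. -/
def IsTurn (π : Equiv.Perm (Fin N)) (k : ℕ) : Prop :=
  ∃ h : k < N, π ⟨k, h⟩ < ⟨k, h⟩ ∧ ∀ h' : k + 1 < N, ⟨k + 1, h'⟩ < π ⟨k + 1, h'⟩

open Classical in
/-- The number of the run of position `k`, that is, the number of turns before `k`. -/
noncomputable def runIndex (π : Equiv.Perm (Fin N)) (k : ℕ) : ℕ :=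
  Nat.count (IsTurn π) k

open Classical in
theorem runIndex_succ (π : Equiv.Perm (Fin N)) (k : ℕ) :
    runIndex π (k + 1) = runIndex π k + if IsTurn π k then 1 else 0 :=
  Nat.count_succ _ _

theorem runIndex_mono (π : Equiv.Perm (Fin N)) : Monotone (runIndex π) := by
  classical
  exact Nat.count_monotone _

theorem IsTurn.runIndex_lt {j k : ℕ} (hj : IsTurn π j) (hjk : j < k) :
    runIndex π j < runIndex π k := by
  classical
  exact Nat.count_strict_mono hj hjk

theorem exists_isTurn_of_closer (hfix : ∀ i, π i ≠ i) {i : Fin N} (hi : π i < i) :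
    ∃ j : Fin N, i ≤ j ∧ IsTurn π j ∧ ∀ k ∈ Set.Icc i j, π k < k := by
  by_cases hturn : IsTurn π i
  · exact ⟨i, le_rfl, hturn, fun k hk => le_antisymm hk.1 hk.2 ▸ hi⟩
  · obtain ⟨h, hsucc⟩ : ∃ h : i + 1 < N, π ⟨i + 1, h⟩ < ⟨i + 1, h⟩ := by
      simp only [IsTurn, Fin.is_lt, Fin.eta, hi, exists_true_left, true_and, not_forall,
        not_lt] at hturn
      exact hturn.imp fun h hle => hle.lt_of_ne (hfix _)
    obtain ⟨j, hij, hj, hall⟩ := exists_isTurn_of_closer hfix hsucc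
    exact ⟨j, by grind, hj, fun k hk => by grind⟩
termination_by N - i

theorem runIndex_lt_of_closer_of_opener (hfix : ∀ i, π i ≠ i) {i k : Fin N} (hik : i < k)
    (hi : π i < i) (hk : k < π k) : runIndex π i < runIndex π k := by
  obtain ⟨j, hij, hj, hall⟩ := exists_isTurn_of_closer hfix hi
  have hjk : j < k := lt_of_not_ge fun hkj => hk.not_gt (hall k ⟨hik.le, hkj⟩)
  exact (runIndex_mono π hij).trans_lt (hj.runIndex_lt hjk)

theorem runIndex_lt_of_closer (hfix : ∀ i, π i ≠ i) {i : Fin N} (hi : π i < i) :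
    runIndex π i < runIndex π N := by
  obtain ⟨j, hij, hj, -⟩ := exists_isTurn_of_closer hfix hi
  exact (runIndex_mono π hij).trans_lt (hj.runIndex_lt j.isLt)

theorem exists_turn_runIndex_eq {i : ℕ} (hi : i < runIndex π N) :
    ∃ k, IsTurn π k ∧ runIndex π k = i := by
  classical
  obtain ⟨k, -, hk⟩ := exists_count_eq_of_lt hi
  exact ⟨k, hk⟩

theorem exists_opener_runIndex_eq (hfix : ∀ i, π i ≠ i) {i : ℕ} (hi : i < runIndex π N) :
    ∃ k : Fin N, k < π k ∧ runIndex π k = i := by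
  obtain _ | i := i
  · have hN : 0 < N := by
      by_contra! h
      simp [runIndex, Nat.le_zero.1 h] at hi
    exact ⟨⟨0, hN⟩, (Fin.le_def.2 (Nat.zero_le _)).lt_of_ne (hfix _).symm, by simp [runIndex]⟩
  · obtain ⟨k, hk, rfl⟩ := exists_turn_runIndex_eq ((Nat.lt_succ_self i).trans hi)
    have hsucc : runIndex π (k + 1) = runIndex π k + 1 := by
      rw [runIndex_succ, if_pos hk]
    have hkN : k + 1 < N := by
      by_contra! h
      exact (runIndex_mono π h).not_gt (hsucc ▸ hi)
    exact ⟨⟨k + 1, hkN⟩, hk.2.2 hkN, hsucc⟩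

theorem IsRegularChordDiagram.apply_lt_apply_of_val_eq_succ (h : IsRegularChordDiagram π)
    {i j : Fin N} (hij : (j : ℕ) = i + 1) (htype : i < π i ↔ j < π j) : π i < π j := by
  by_contra! hle
  have := h.2.2 i j hij (hle.lt_of_ne (π.injective.ne (by grind)))
  grind

theorem IsRegularChordDiagram.apply_lt_apply_of_runIndex_eq (h : IsRegularChordDiagram π)
    {i k : Fin N} (hik : i < k) (htype : i < π i ↔ k < π k)
    (hrun : runIndex π i = runIndex π k) : π i < π k := by
  have hconst {j : Fin N} (hj : j ∈ Set.Icc i k) : j < π j ↔ i < π i := by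
    have hij := runIndex_mono π (Fin.le_def.1 hj.1)
    have hjk := runIndex_mono π (Fin.le_def.1 hj.2)
    have h1 := @runIndex_lt_of_closer_of_opener _ _ h.2.1 i j
    have h2 := @runIndex_lt_of_closer_of_opener _ _ h.2.1 j k
    have h3 := h.2.1 i
    have h4 := h.2.1 j
    grind
  refine strictMonoOn_of_lt_succ Set.ordConnected_Icc (fun j hj hmem hmem' => ?_)
    (Set.left_mem_Icc.2 hik.le) (Set.right_mem_Icc.2 hik.le) hik
  refine h.apply_lt_apply_of_val_eq_succ ?_ ((hconst hmem).trans (hconst hmem').symm)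
  exact (Nat.covBy_iff_add_one_eq.1 (Fin.covBy_iff.1 (Order.covBy_succ_of_not_isMax hj))).symm

end Runs

/-! ### Arranging the ends of intervals on a line -/

section Arrangement

variable {n m : ℕ} {p : Fin n → ℕ × ℕ}

/-- The endpoint of an interval. The ends of the interval number `i` are `(i, false)` on the left
and `(i, true)` on the right. -/
def endRun (p : Fin n → ℕ × ℕ) (x : Fin n × Bool) : ℕ :=
  if x.2 then (p x.1).2 else (p x.1).1

/-- The involution exchanging the two ends of each interval. -/
def partner (n : ℕ) : Equiv.Perm (Fin n × Bool) :=
  (Equiv.refl (Fin n)).prodCongr Equiv.boolNot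

theorem partner_mk (i : Fin n) (b : Bool) : partner n (i, b) = (i, !b) := rfl

theorem partner_partner (x : Fin n × Bool) : partner n (partner n x) = x := by
  obtain ⟨i, b⟩ := x
  simp only [partner_mk, Bool.not_not]

theorem partner_ne (x : Fin n × Bool) : partner n x ≠ x := by
  obtain ⟨i, b⟩ := x
  simp [partner_mk]

/-- The sort key of an end: in a chord diagram, ends are ordered by their run, within a run openers
precede closers, and among the openers and among the closers of a run the partners are ordered like
the ends themselves. Equal intervals are ordered by number. -/
def endKey (p : Fin n → ℕ × ℕ) (x : Fin n × Bool) : ℕ ×ₗ Bool ×ₗ ℕ ×ₗ Fin n :=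
  toLex (endRun p x, toLex (x.2, toLex (endRun p (partner n x), x.1)))

theorem endKey_lt_endKey_iff {x y : Fin n × Bool} :
    endKey p x < endKey p y ↔ endRun p x < endRun p y ∨ endRun p x = endRun p y ∧
      (x.2 < y.2 ∨ x.2 = y.2 ∧ (endRun p (partner n x) < endRun p (partner n y) ∨
        endRun p (partner n x) = endRun p (partner n y) ∧ x.1 < y.1)) := by
  simp only [endKey, Prod.Lex.toLex_lt_toLex]

theorem endKey_injective (p : Fin n → ℕ × ℕ) : Function.Injective (endKey p) := by
  intro x y h
  simp only [endKey, toLex_inj, Prod.mk.injEq] at h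
  exact Prod.ext h.2.2.2 h.2.1

theorem endKey_lt_of_endRun_lt {x y : Fin n × Bool} (h : endRun p x < endRun p y) :
    endKey p x < endKey p y :=
  endKey_lt_endKey_iff.2 (Or.inl h)

theorem endKey_lt_of_endRun_eq {x y : Fin n × Bool} (h : endRun p x = endRun p y)
    (hx : x.2 = false) (hy : y.2 = true) : endKey p x < endKey p y :=
  endKey_lt_endKey_iff.2 (Or.inr ⟨h, Or.inl (by rw [hx, hy]; decide)⟩)

theorem endRun_le_of_endKey_lt {x y : Fin n × Bool} (h : endKey p x < endKey p y) :
    endRun p x ≤ endRun p y := by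
  by_contra! hlt
  exact h.not_gt (endKey_lt_of_endRun_lt hlt)

theorem endKey_partner_lt {x y : Fin n × Bool} (h : endKey p x < endKey p y)
    (hrun : endRun p x = endRun p y) (htype : x.2 = y.2) :
    endKey p (partner n x) < endKey p (partner n y) := by
  have h' := endKey_lt_endKey_iff.1 h
  simp only [hrun, htype, lt_irrefl, true_and, false_or] at h'
  rw [endKey_lt_endKey_iff, partner_partner, partner_partner, hrun]
  have htype' : (partner n x).2 = (partner n y).2 := congrArg Bool.not htype
  exact h'.imp_right fun h' => ⟨h'.1, Or.inr ⟨htype', Or.inr ⟨rfl, h'.2⟩⟩⟩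

theorem exists_equiv_strictMono {α β : Type*} [Fintype α] [LinearOrder β] {N : ℕ}
    (hN : Fintype.card α = N) {f : α → β} (hf : Function.Injective f) :
    ∃ e : Fin N ≃ α, StrictMono (f ∘ e) := by
  let e := Equiv.ofInjective f hf
  let _ : Fintype (Set.range f) := Fintype.ofEquiv α e
  have hcard : Fintype.card (Set.range f) = N := (Fintype.card_congr e).symm.trans hN
  let g := Fintype.orderIsoFinOfCardEq (Set.range f) hcard
  refine ⟨g.toEquiv.trans e.symm, fun i j hij => ?_⟩
  simpa [e, Equiv.apply_ofInjective_symm] using g.strictMono hij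

theorem equiv_eq_of_strictMono {α β : Type*} [LinearOrder β] {N : ℕ} {f : α → β}
    (hf : Function.Injective f) {e e' : Fin N ≃ α} (he : StrictMono (f ∘ e))
    (he' : StrictMono (f ∘ e')) : e = e' := by
  have h : f ∘ e = f ∘ e' := by
    rw [← he.range_inj he', e.surjective.range_comp, e'.surjective.range_comp]
  exact Equiv.coe_fn_injective (hf.comp_left h)

/-- The chord diagram whose chords are the intervals, the position `k` being the end `e k`. -/
def diagram (e : Fin (2 * n) ≃ Fin n × Bool) : Equiv.Perm (Fin (2 * n)) :=
  e.symm.permCongr (partner n)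

variable {e : Fin (2 * n) ≃ Fin n × Bool}

theorem apply_diagram (e : Fin (2 * n) ≃ Fin n × Bool) (k : Fin (2 * n)) :
    e (diagram e k) = partner n (e k) := by
  simp [diagram]

theorem diagram_diagram (e : Fin (2 * n) ≃ Fin n × Bool) (k : Fin (2 * n)) :
    diagram e (diagram e k) = k :=
  e.injective (by rw [apply_diagram, apply_diagram, partner_partner])

theorem lt_diagram_iff (hp : IsIntervalSet (Set.range p) m) (he : StrictMono (endKey p ∘ e))
    (k : Fin (2 * n)) : k < diagram e k ↔ (e k).2 = false := by
  have hlt (i : Fin n) : endKey p (i, false) < endKey p (i, true) := by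
    obtain h | h := (hp.fst_le_snd ⟨i, rfl⟩).lt_or_eq
    · exact endKey_lt_of_endRun_lt h
    · exact endKey_lt_of_endRun_eq h rfl rfl
  rw [← he.lt_iff_lt, Function.comp_apply, Function.comp_apply, apply_diagram]
  obtain ⟨i, _ | _⟩ := e k
  · exact iff_of_true (hlt i) rfl
  · exact iff_of_false (hlt i).not_gt Bool.true_eq_false.mp

theorem diagram_lt_iff (hp : IsIntervalSet (Set.range p) m) (he : StrictMono (endKey p ∘ e))
    (k : Fin (2 * n)) : diagram e k < k ↔ (e k).2 = true := by
  have h := lt_diagram_iff hp he (diagram e k)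
  rw [diagram_diagram, apply_diagram] at h
  rw [h]
  obtain ⟨i, _ | _⟩ := e k <;> simp [partner_mk]

theorem endRun_lt (hp : IsIntervalSet (Set.range p) m) (x : Fin n × Bool) : endRun p x < m := by
  obtain ⟨i, _ | _⟩ := x
  · exact hp.fst_lt ⟨i, rfl⟩
  · exact hp.snd_lt ⟨i, rfl⟩

theorem exists_endRun_eq (hp : IsIntervalSet (Set.range p) m) (b : Bool) {i : ℕ} (hi : i < m) :
    ∃ x : Fin n × Bool, x.2 = b ∧ endRun p x = i := by
  obtain _ | _ := b
  · obtain ⟨_, ⟨j, rfl⟩, hj⟩ := hp.image_fst.superset hi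
    exact ⟨(j, false), rfl, hj⟩
  · obtain ⟨_, ⟨j, rfl⟩, hj⟩ := hp.image_snd.superset hi
    exact ⟨(j, true), rfl, hj⟩

theorem endRun_of_val_eq_succ (hp : IsIntervalSet (Set.range p) m)
    (he : StrictMono (endKey p ∘ e)) {k l : Fin (2 * n)} (hkl : (l : ℕ) = k + 1) :
    endRun p (e l) =
      endRun p (e k) + if (e k).2 = true ∧ (e l).2 = false then 1 else 0 := by
  have hno (x : Fin n × Bool) (hx : endKey p (e k) < endKey p x) :
      ¬ endKey p x < endKey p (e l) := fun hx' => by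
    obtain ⟨j, rfl⟩ := e.surjective x
    have h1 := he.lt_iff_lt.1 hx
    have h2 := he.lt_iff_lt.1 hx'
    grind
  have hlt : endKey p (e k) < endKey p (e l) := he (Fin.lt_def.2 (by omega))
  have hle := endRun_le_of_endKey_lt hlt
  split_ifs with h
  · obtain ⟨hk, hl⟩ := h
    have hne : endRun p (e k) ≠ endRun p (e l) := fun heq =>
      hlt.not_gt (endKey_lt_of_endRun_eq heq.symm hl hk)
    by_contra hcon
    have hm : endRun p (e k) + 1 < m := by have := endRun_lt hp (e l); omega
    obtain ⟨x, -, hxrun⟩ := exists_endRun_eq hp false hm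
    exact hno x (endKey_lt_of_endRun_lt (by omega)) (endKey_lt_of_endRun_lt (by omega))
  · by_contra hcon
    have hrun : endRun p (e k) < endRun p (e l) := by omega
    cases hk : (e k).2
    · obtain ⟨x, hx, hxrun⟩ := exists_endRun_eq hp true (endRun_lt hp (e k))
      exact hno x (endKey_lt_of_endRun_eq hxrun.symm hk hx) (endKey_lt_of_endRun_lt (by omega))
    · have hl : (e l).2 = true := by simpa [hk] using h
      obtain ⟨x, hx, hxrun⟩ := exists_endRun_eq hp false (endRun_lt hp (e l))
      exact hno x (endKey_lt_of_endRun_lt (by omega)) (endKey_lt_of_endRun_eq hxrun hx hl)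

theorem runIndex_diagram (hp : IsIntervalSet (Set.range p) m) (he : StrictMono (endKey p ∘ e))
    (k : Fin (2 * n)) : runIndex (diagram e) k = endRun p (e k) := by
  classical
  obtain ⟨k, hk⟩ := k
  induction k with
  | zero =>
    obtain ⟨x, -, hx⟩ := exists_endRun_eq hp false (Nat.zero_lt_of_lt (endRun_lt hp (e ⟨0, hk⟩)))
    have hle : endRun p (e ⟨0, hk⟩) ≤ endRun p x := by
      obtain ⟨j, rfl⟩ := e.surjective x
      obtain h | h := (Fin.le_def.2 (Nat.zero_le j) : ⟨0, hk⟩ ≤ j).eq_or_lt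
      · rw [h]
      · exact endRun_le_of_endKey_lt (he h)
    exact (Nat.le_zero.1 (hle.trans_eq hx)).symm
  | succ k ih =>
    have hturn : IsTurn (diagram e) k ↔
        (e ⟨k, Nat.lt_of_succ_lt hk⟩).2 = true ∧ (e ⟨k + 1, hk⟩).2 = false := by
      simp only [IsTurn, lt_diagram_iff hp he, diagram_lt_iff hp he, hk,
        (Nat.lt_succ_self k).trans hk, exists_true_left, forall_true_left]
    rw [runIndex_succ, ih (Nat.lt_of_succ_lt hk),
      endRun_of_val_eq_succ hp he (k := ⟨k, Nat.lt_of_succ_lt hk⟩)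
        (l := ⟨k + 1, hk⟩) rfl]
    simp only [hturn]

theorem isRegularChordDiagram_diagram (hp : IsIntervalSet (Set.range p) m)
    (he : StrictMono (endKey p ∘ e)) : IsRegularChordDiagram (diagram e) := by
  refine ⟨diagram_diagram e, fun k hk => ?_, fun k l hkl hlt => ?_⟩
  · have := apply_diagram e k
    rw [hk] at this
    exact partner_ne _ this.symm
  · have hrun := endRun_of_val_eq_succ hp he hkl
    have hkey : endKey p (e k) < endKey p (e l) := he (Fin.lt_def.2 (by omega))
    have hkey' : endKey p (partner n (e l)) < endKey p (partner n (e k)) := by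
      simpa only [Function.comp_apply, apply_diagram] using he hlt
    have htype : (e k).2 ≠ (e l).2 := fun htype => by
      rw [if_neg (by rw [htype]; simp), Nat.add_zero] at hrun
      exact hkey'.not_gt (endKey_partner_lt hkey hrun.symm htype)
    grind [lt_diagram_iff, diagram_lt_iff]

end Arrangement

/-! ### Chord diagrams and interval systems -/

section ChordIntervals

/-- The positions where the chords of a chord diagram start. -/
def openers {N : ℕ} (π : Equiv.Perm (Fin N)) : Finset (Fin N) := {k | k < π k}

/-- The intervals of runs spanned by the chords of a chord diagram. -/
noncomputable def chordIntervals {N : ℕ} (π : Equiv.Perm (Fin N)) : Multiset (ℕ × ℕ) :=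
  (openers π).val.map fun k : Fin N => (runIndex π k, runIndex π (π k))

theorem isIntervalSet_chordIntervals {N : ℕ} {π : Equiv.Perm (Fin N)} (hinv : ∀ i, π (π i) = i)
    (hfix : ∀ i, π i ≠ i) : IsIntervalSet {x | x ∈ chordIntervals π} (runIndex π N) := by
  have hset : {x | x ∈ chordIntervals π} =
      (fun k : Fin N => (runIndex π k, runIndex π (π k))) '' {k | k < π k} := by
    ext x
    simp [chordIntervals, openers]
  have hcloser {k : Fin N} (hk : k < π k) : runIndex π (π k) < runIndex π N :=
    runIndex_lt_of_closer hfix (by rwa [hinv])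
  rw [hset]
  refine ⟨?_, ?_, ?_⟩
  · rintro _ ⟨k, hk, rfl⟩
    exact runIndex_mono π (le_of_lt hk)
  · ext i
    rw [Set.image_image]
    constructor
    · rintro ⟨k, hk, rfl⟩
      exact (runIndex_mono π (le_of_lt hk)).trans_lt (hcloser hk)
    · exact exists_opener_runIndex_eq hfix
  · ext i
    rw [Set.image_image]
    constructor
    · rintro ⟨k, hk, rfl⟩
      exact hcloser hk
    · intro hi
      obtain ⟨k, ⟨hkN, hk, -⟩, rfl⟩ := exists_turn_runIndex_eq hi
      refine ⟨π ⟨k, hkN⟩, ?_, ?_⟩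
      · rwa [Set.mem_ofPred, hinv]
      · simp only [hinv]

variable {n m : ℕ} {π : Equiv.Perm (Fin (2 * n))}

theorem card_openers (hinv : ∀ i, π (π i) = i) (hfix : ∀ i, π i ≠ i) : #(openers π) = n := by
  have hcompl : #(openers π) = #{k | ¬ k < π k} := by
    refine card_equiv π fun k => ?_
    have := hfix k
    grind [openers]
  have hsum := card_filter_add_card_filter_not (s := (univ : Finset (Fin (2 * n)))) fun k => k < π k
  rw [← hcompl, ← openers, card_univ, Fintype.card_fin] at hsum
  omega

/-- The family of intervals of runs spanned by the chords starting at the positions `a i`. -/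
noncomputable def runFamily {N : ℕ} (π : Equiv.Perm (Fin N)) (a : Fin n → Fin N) (i : Fin n) :
    ℕ × ℕ :=
  (runIndex π (a i), runIndex π (π (a i)))

theorem chordIntervals_eq_symOf {N : ℕ} {π : Equiv.Perm (Fin N)} {a : Fin n → Fin N}
    (hinj : Function.Injective a) (ha : Set.range a = {k | k < π k}) :
    chordIntervals π = symOf (runFamily π a) := by
  have hopeners : openers π = univ.map ⟨a, hinj⟩ := by
    ext k
    simpa [openers] using (Set.ext_iff.1 ha k).symm
  rw [chordIntervals, hopeners, Finset.map_val, Multiset.map_map]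
  rfl

theorem chordIntervals_diagram {p : Fin n → ℕ × ℕ} {e : Fin (2 * n) ≃ Fin n × Bool}
    (hp : IsIntervalSet (Set.range p) m) (he : StrictMono (endKey p ∘ e)) :
    chordIntervals (diagram e) = symOf p := by
  let a (i : Fin n) : Fin (2 * n) := e.symm (i, false)
  have hinj : Function.Injective a := e.symm.injective.comp (Prod.mk_left_injective false)
  have ha : Set.range a = {k | k < diagram e k} := by
    ext k
    obtain ⟨⟨i, b⟩, rfl⟩ := e.symm.surjective k
    simp only [a, Set.mem_range, Set.mem_ofPred, lt_diagram_iff hp he, Equiv.apply_symm_apply,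
      EmbeddingLike.apply_eq_iff_eq, Prod.mk.injEq]
    exact ⟨fun ⟨_, _, hb⟩ => hb.symm, fun hb => ⟨i, rfl, hb.symm⟩⟩
  have hfamily : runFamily (diagram e) a = p := by
    funext i
    rw [runFamily, runIndex_diagram hp he, runIndex_diagram hp he, apply_diagram,
      Equiv.apply_symm_apply]
    rfl
  rw [chordIntervals_eq_symOf hinj ha, hfamily]

/-- The position of an end in a chord diagram whose chords start at the positions `a i`. -/
def endPosition (π : Equiv.Perm (Fin (2 * n))) (a : Fin n → Fin (2 * n)) (x : Fin n × Bool) :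
    Fin (2 * n) :=
  if x.2 then π (a x.1) else a x.1

section EndPosition

variable {a : Fin n → Fin (2 * n)}

theorem apply_endPosition (hinv : ∀ i, π (π i) = i) (x : Fin n × Bool) :
    π (endPosition π a x) = endPosition π a (partner n x) := by
  obtain ⟨i, _ | _⟩ := x <;> simp [endPosition, partner_mk, hinv]

theorem endPosition_lt_iff (hinv : ∀ i, π (π i) = i) (ha : ∀ i, a i < π (a i)) (x : Fin n × Bool) :
    endPosition π a x < π (endPosition π a x) ↔ x.2 = false := by
  obtain ⟨i, _ | _⟩ := x
  · simp [endPosition, ha]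
  · simp [endPosition, hinv, (ha i).le]

theorem endPosition_bijective (hinv : ∀ i, π (π i) = i) (hinj : Function.Injective a)
    (ha : ∀ i, a i < π (a i)) : Function.Bijective (endPosition π a) := by
  rw [Fintype.bijective_iff_injective_and_card]
  refine ⟨?_, by simp [mul_comm]⟩
  rintro ⟨i, b⟩ ⟨j, c⟩ h
  have htype := endPosition_lt_iff hinv ha (i, b)
  rw [h, endPosition_lt_iff hinv ha] at htype
  obtain rfl : c = b := by grind
  cases c <;> simpa [endPosition, hinj.eq_iff] using h

theorem runIndex_endPosition (π : Equiv.Perm (Fin (2 * n))) (a : Fin n → Fin (2 * n))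
    (x : Fin n × Bool) : runIndex π (endPosition π a x) = endRun (runFamily π a) x := by
  obtain ⟨i, _ | _⟩ := x <;> rfl

theorem IsRegularChordDiagram.endKey_lt_endKey (h : IsRegularChordDiagram π)
    (hmono : StrictMono a) (ha : ∀ i, a i < π (a i)) {x y : Fin n × Bool}
    (hlt : endPosition π a x < endPosition π a y) :
    endKey (runFamily π a) x < endKey (runFamily π a) y := by
  have hx := endPosition_lt_iff h.1 ha x
  have hy := endPosition_lt_iff h.1 ha y
  rw [endKey_lt_endKey_iff]
  simp only [← runIndex_endPosition, ← apply_endPosition h.1]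
  refine (runIndex_mono π hlt.le).lt_or_eq.imp_right fun hrun => ⟨hrun, ?_⟩
  obtain htype | htype | htype := lt_trichotomy x.2 y.2
  · exact Or.inl htype
  · have hlt' := h.apply_lt_apply_of_runIndex_eq hlt (by rw [hx, hy, htype]) hrun
    refine Or.inr ⟨htype, (runIndex_mono π hlt'.le).lt_or_eq.imp_right fun hrun' => ⟨hrun', ?_⟩⟩
    rw [apply_endPosition h.1, apply_endPosition h.1] at hlt'
    obtain ⟨i, b⟩ := x
    obtain ⟨j, c⟩ := y
    obtain rfl : b = c := htype
    obtain _ | _ := b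
    · exact hmono.lt_iff_lt.1 hlt
    · exact hmono.lt_iff_lt.1 hlt'
  · obtain ⟨hyf, hxt⟩ := Bool.lt_iff.1 htype
    have hcloser : π (endPosition π a x) < endPosition π a x :=
      (not_lt.1 (by simp [hx, hxt])).lt_of_ne (h.2.1 _)
    exact absurd hrun (runIndex_lt_of_closer_of_opener h.2.1 hlt hcloser (hy.2 hyf)).ne

theorem IsRegularChordDiagram.monotone_runFamily (h : IsRegularChordDiagram π)
    (hmono : StrictMono a) (ha : ∀ i, a i < π (a i)) : Monotone (toLex ∘ runFamily π a) := by
  intro i j hij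
  obtain rfl | hlt := hij.eq_or_lt
  · exact le_rfl
  · have hkey := h.endKey_lt_endKey hmono ha (x := (i, false)) (y := (j, false)) (hmono hlt)
    rw [endKey_lt_endKey_iff] at hkey
    simp only [lt_irrefl, false_or, true_and] at hkey
    exact Prod.Lex.toLex_le_toLex.2
      (hkey.imp_right fun hkey => ⟨hkey.1, hkey.2.elim le_of_lt fun hkey => hkey.1.le⟩)

theorem IsRegularChordDiagram.exists_eq_diagram (h : IsRegularChordDiagram π) :
    ∃ (p : Fin n → ℕ × ℕ) (e : Fin (2 * n) ≃ Fin n × Bool), Monotone (toLex ∘ p) ∧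
      chordIntervals π = symOf p ∧ StrictMono (endKey p ∘ e) ∧ π = diagram e := by
  let a := (openers π).orderEmbOfFin (card_openers h.1 h.2.1)
  have hrange : Set.range a = {k | k < π k} := by
    rw [range_orderEmbOfFin]
    simp [openers]
  have ha (i : Fin n) : a i < π (a i) := hrange.subset ⟨i, rfl⟩
  let e := (Equiv.ofBijective _ (endPosition_bijective h.1 a.injective ha)).symm
  have he (k : Fin (2 * n)) : endPosition π a (e k) = k := e.symm_apply_apply k
  refine ⟨runFamily π a, e, h.monotone_runFamily a.strictMono ha,
    chordIntervals_eq_symOf a.injective hrange, fun k l hkl => ?_, ?_⟩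
  · exact h.endKey_lt_endKey a.strictMono ha (by rwa [he, he])
  · ext1 k
    rw [← he (diagram e k), apply_diagram, ← apply_endPosition h.1, he]

end EndPosition

theorem chordIntervals_injOn :
    Set.InjOn (chordIntervals (N := 2 * n)) {π | IsRegularChordDiagram π} := by
  intro π h π' h' heq
  obtain ⟨p, e, hp, hπ, he, rfl⟩ := IsRegularChordDiagram.exists_eq_diagram h
  obtain ⟨p', e', hp', hπ', he', rfl⟩ := IsRegularChordDiagram.exists_eq_diagram h'
  obtain ⟨σ, rfl⟩ := symOf_eq_iff.1 (Sym.coe_injective (hπ.symm.trans (heq.trans hπ')))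
  have hpp : p' ∘ σ = p' :=
    toLex.injective.comp_left (Tuple.unique_monotone (f := toLex ∘ p') (τ := 1) hp hp')
  rw [hpp] at he
  rw [equiv_eq_of_strictMono (endKey_injective p') he he']

theorem exists_regularChordDiagram (s : IntervalMultiset n) :
    ∃ π : Equiv.Perm (Fin (2 * n)), IsRegularChordDiagram π ∧ chordIntervals π = s.1 := by
  obtain ⟨s, m, hs⟩ := s
  obtain ⟨p, rfl⟩ := symOf_surjective s
  rw [setOf_mem_symOf] at hs
  obtain ⟨e, he⟩ := exists_equiv_strictMono (N := 2 * n) (by simp [mul_comm]) (endKey_injective p)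
  exact ⟨diagram e, isRegularChordDiagram_diagram hs he, chordIntervals_diagram hs he⟩

theorem card_regularChordDiagram (n : ℕ) :
    Nat.card {π : Equiv.Perm (Fin (2 * n)) // IsRegularChordDiagram π} =
      Nat.card (IntervalMultiset n) := by
  let f (π : {π : Equiv.Perm (Fin (2 * n)) // IsRegularChordDiagram π}) : IntervalMultiset n :=
    ⟨⟨chordIntervals π.1, (Multiset.card_map _ _).trans (card_openers π.2.1 π.2.2.1)⟩,
      _, isIntervalSet_chordIntervals π.2.1 π.2.2.1⟩
  refine Nat.card_eq_of_bijective f ⟨fun π π' h => ?_, fun s => ?_⟩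
  · exact Subtype.ext <| chordIntervals_injOn π.2 π'.2 <|
      congrArg (fun s : IntervalMultiset n => (s.1 : Multiset (ℕ × ℕ))) h
  · obtain ⟨π, hπ, hs⟩ := exists_regularChordDiagram s
    exact ⟨⟨π, hπ⟩, Subtype.ext (Sym.coe_injective hs)⟩

end ChordIntervals

/-! ### Comparison of the generating functions -/

theorem posetSeries_eq : posetSeries = intervalSeries := by
  ext n
  rw [posetSeries, coeff_mk, card_unlabeledPoset, intervalSeries, coeff_mk]

theorem chordSeries_eq : chordSeries = intervalSeries := by
  ext n
  rw [chordSeries, coeff_mk, card_regularChordDiagram, intervalSeries, coeff_mk]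

theorem X_pow_dvd_treeSeries_sub (N : ℕ) :
    (X : ℤ⟦X⟧) ^ N ∣ 1 + X * treeSeries 0 0 - ∑ k ∈ range N, qPoch (1 - X) k := by
  have hX : 1 - (oneSubX : ℤ⟦X⟧) = X := sub_sub_cancel 1 X
  have h := one_sub_pow_dvd_tree_sub_sum_qPoch oneSubX (F := treeSeries)
    (fun a l => by rw [hX]; exact treeSeries_eq a l) N
  rwa [hX] at h

theorem eq_of_forall_X_pow_dvd_sub {R : Type*} [CommRing R] {f g : R⟦X⟧} {u : ℕ → R⟦X⟧}
    (hf : ∀ N, X ^ N ∣ f - u N) (hg : ∀ N, X ^ N ∣ g - u N) : f = g := by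
  ext n
  have h := dvd_sub (hf (n + 1)) (hg (n + 1))
  rw [sub_sub_sub_cancel_right] at h
  exact sub_eq_zero.1 (X_pow_dvd_iff.1 h n n.lt_succ_self)

theorem treeSeries_eq_intervalSeries : 1 + X * treeSeries 0 0 = intervalSeries :=
  eq_of_forall_X_pow_dvd_sub X_pow_dvd_treeSeries_sub X_pow_dvd_intervalSeries_sub

theorem X_pow_dvd_qPoch {R : Type*} [CommRing R] (k : ℕ) :
    (X : R⟦X⟧) ^ k ∣ qPoch (1 - X) k := by
  have h := one_sub_pow_dvd_qPoch (1 - X : R⟦X⟧) k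
  rwa [sub_sub_cancel] at h

theorem hasSum_of_X_pow_dvd {R : Type*} [CommRing R] [TopologicalSpace R] {f : R⟦X⟧}
    {u : ℕ → R⟦X⟧} (hu : ∀ k, X ^ k ∣ u k) (hf : ∀ N, X ^ N ∣ f - ∑ k ∈ range N, u k) :
    HasSum u f := by
  rw [PowerSeries.WithPiTopology.hasSum_iff_hasSum_coeff]
  intro n
  have hcoeff : coeff n f = ∑ k ∈ range (n + 1), coeff n (u k) := by
    rw [← map_sum]
    exact sub_eq_zero.1 (X_pow_dvd_iff.1 (hf (n + 1)) n n.lt_succ_self)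
  rw [hcoeff]
  exact hasSum_sum_of_ne_finset_zero fun k hk =>
    X_pow_dvd_iff.1 (hu k) n (by simpa using hk)

theorem hasSum_qPoch : HasSum (qPoch (1 - X)) intervalSeries :=
  hasSum_of_X_pow_dvd X_pow_dvd_qPoch X_pow_dvd_intervalSeries_sub

end Fishburn

/-- Convergence of the sum is that of formal power series: coefficientwise, with `ℤ` discrete. -/
theorem theorem6p1 :
    HasSum
      (fun n : ℕ => ∏ i ∈ Finset.Icc 1 n, (1 - (1 - (PowerSeries.X : PowerSeries ℤ)) ^ i))
      Fishburn.posetSeries ∧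
    Fishburn.ascentSeries = Fishburn.posetSeries ∧
    Fishburn.permSeries = Fishburn.posetSeries ∧
    Fishburn.chordSeries = Fishburn.posetSeries := by
  rw [Fishburn.posetSeries_eq, Fishburn.ascentSeries_eq, Fishburn.permSeries_eq,
    Fishburn.chordSeries_eq, Fishburn.treeSeries_eq_intervalSeries]
  exact ⟨Fishburn.hasSum_qPoch, rfl, rfl, rfl⟩
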